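/- Let $A$ be a commutative ring and let $W_n(A)$ denote the ring of $2$-typical Witt vectors of length $n$, with restriction $R$, Frobenius $F$, Verschiebung $V$ and Teichmüller representatives $[a]_n=(a,0,\dots,0)$. A *$2$-typical Witt complex* over $A$ consists of graded rings $E_n^*$ ($n\ge 0$, with $E_0^*=0$), graded-commutative in the sense that $xy=(-1)^{|x||y|}yx$, with maps of graded rings $R:E_n^*\to E_{n-1}^*$, together with * ring maps $\lambda:W_n(A)\to E_n^0$, * maps of graded rings $F:E_n^*\to E_{n-1}^*$ with $\lambda F=F\lambda$, * additive degree-preserving maps $V:E_n^*\to E_{n+1}^*$ with $\lambda V=V\lambda$, $FV=2$ and $V(x)y=V(xF(y))$, * additive maps $d:E_n^q\to E_n^{q+1}$ with $d(xy)=d(x)y+(-1)^{|x|}x\,d(y)$, all compatible with $R$, such that, with $\iota:E_n^q\to E_n^{q+1}$ denoting multiplication by $d\lambda([-1]_n)/\lambda([-1]_n)$, $$FdV=d+\iota,\qquad dd=d\iota=\iota d,\qquad Fd\lambda([a]_n)=\lambda([a]_{n-1})\,d\lambda([a]_{n-1})\quad(a\in A).$$ Maps of Witt complexes are maps of graded rings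 at each level, commuting with $R,\lambda,d,F,V$. The *$2$-typical de Rham–Witt complex* $W_\bullet\Omega_A^*$ is the initial object of the category of $2$-typical Witt complexes over $A$. Write $V^i(1)\in W_n\Omega^0_A$ for $V^i([1]_{n-i})$, and $dV^i(1)$ for its image under $d$. **Theorem.** Let $A=\mathbb Z$ or $A=\mathbb Z_{(2)}$. Then $W_\bullet\Omega_A^*$ exists and its structure is as follows, for all $n$. 1. $\lambda:W_n(A)\to W_n\Omega^0_A$ is an isomorphism, and as abelian groups $$W_n\Omega^0_A=\bigoplus_{i=0}^{n-1}A\cdot V^i(1),\qquad W_n\Omega^1_A=\bigoplus_{i=1}^{n-1}\mathbb Z/2^i\mathbb Z\cdot dV^i(1),\qquad W_n\Omega^q_A=0\ \ (q\ge 2).$$ 2. The product is given, for indices $<n$, by $V^i(1)V^j(1)=2^iV^j(1)$ if $i\le j$, and $$V^i(1)\,dV^j(1)=\begin{cases}2^i\,dV^j(1)+\sum_{s=j+1}^{n-1}2^{s-1}dV^s(1), & 1\le i<j,\\[2pt] \sum_{s=i+1}^{n-1}2^{s-1}dV^s(1), & 1\le j\le i.\end{cases}$$ 3. The maps $V:W_n\Omega^*_A\to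 W_{n+1}\Omega^*_A$ satisfy $V(V^i(1))=V^{i+1}(1)$ for $0\le i<n$, and $V(dV^i(1))=2\,dV^{i+1}(1)$ for $1\le i<n$. 4. The maps $F:W_n\Omega^*_A\to W_{n-1}\Omega^*_A$ satisfy, for $1\le i\le n-1$, $F(V^i(1))=2V^{i-1}(1)$ and $F(dV^i(1))=dV^{i-1}(1)+\sum_{s=i}^{n-2}2^{s-1}dV^s(1)$ (where $dV^0(1)=d(1)=0$). 5. $d$ sends $V^i(1)$ to $dV^i(1)$ for $i\ge 1$, $d(1)=0$, and $\iota(V^i(1))=\sum_{s=i+1}^{n-1}2^{s-1}dV^s(1)$ for $0\le i<n$. 6. The maps $R:W_n\Omega^*_A\to W_{n-1}\Omega^*_A$ ($n\ge1$) satisfy $R(V^i(1))=V^i(1)$ for $0\le i\le n-2$ and $R(dV^i(1))=dV^i(1)$ for $1\le i\le n-2$; moreover $R(V^{n-1}(1))=0$, and $R(dV^{n-1}(1))=0$ if $n\ge2$. -/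

import Mathlib

open CategoryTheory

universe u

/-! ### Truncated 2-typical Witt vectors `W_n(A)` -/

/-- The ring `W_n(A)` of `2`-typical Witt vectors of length `n`. -/
abbrev TwoWitt (n : ℕ) (A : Type u) : Type u := TruncatedWittVector 2 n A

namespace TwoWitt

noncomputable section

variable {A : Type u} [CommRing A]

/-- The restriction `R : W_{n+1}(A) → W_n(A)` (forget the last component). -/
def res (n : ℕ) : TwoWitt (n + 1) A →+* TwoWitt n A :=
  TruncatedWittVector.truncate (Nat.le_succ n)

/-- The Frobenius `F : W_{n+1}(A) → W_n(A)`: lift to `W(A)`, apply the Frobenius of `W(A)` and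
truncate. It does not depend on the lift, see `TwoWitt.frob_truncate`. -/
def frob (n : ℕ) (x : TwoWitt (n + 1) A) : TwoWitt n A :=
  WittVector.truncate n (WittVector.frobenius x.out)

/-- The Verschiebung `V : W_n(A) → W_{n+1}(A)`, `(a_0, …, a_{n-1}) ↦ (0, a_0, …, a_{n-1})`. -/
def ver (n : ℕ) (x : TwoWitt n A) : TwoWitt (n + 1) A :=
  WittVector.truncate (n + 1) (WittVector.verschiebung x.out)

/-- The Teichmüller representative `[a]_n = (a, 0, …, 0) ∈ W_n(A)`. -/
def teich (n : ℕ) (a : A) : TwoWitt n A :=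
  WittVector.truncate n (WittVector.teichmuller 2 a)

theorem teich_neg_one_mul_self (n : ℕ) : teich n (-1 : A) * teich n (-1 : A) = 1 := by
  unfold teich
  rw [← map_mul, ← map_mul]
  simp

/-- The Frobenius of `W_n` is induced by the Frobenius of `W`. -/
theorem frob_truncate (n : ℕ) (x : WittVector 2 A) :
    frob n (WittVector.truncate (n + 1) x) = WittVector.truncate n (WittVector.frobenius x) := by
  have h1 : (WittVector.truncate (n + 1) x : TwoWitt (n + 1) A).out = WittVector.init (n + 1) x :=
    WittVector.out_truncateFun x
  have h2 := WittVector.eq_iterate_verschiebung (x := WittVector.tail (n + 1) x) (n := n + 1)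
    (fun i hi => by
      simp only [WittVector.tail, WittVector.select, WittVector.coeff_mk]
      exact if_neg (by omega))
  unfold frob
  rw [h1]
  conv_rhs => rw [← WittVector.init_add_tail x (n + 1), map_add, map_add]
  rw [left_eq_add, h2, Function.iterate_succ_apply', WittVector.frobenius_verschiebung, map_mul]
  have : WittVector.truncate n
      ((WittVector.verschiebung)^[n] ((WittVector.tail (n + 1) x).shift (n + 1))) = 0 := by
    rw [← RingHom.mem_ker, WittVector.mem_ker_truncate]
    intro i hi
    exact WittVector.iterate_verschiebung_coeff_eq_zero _ hi
  rw [this, zero_mul]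

end

end TwoWitt

/-! ### 2-typical Witt complexes -/

/-- The objects and operators of a 2-typical Witt complex over `A`. Levels are indexed by `ℕ`, with
level `0` trivial; the (trivial) negative levels carry no information and are left out.
`X n` is the total ring of the graded ring `E_n^*`, and `deg n q` is its component `E_n^q`. -/
structure PreWittComplex (A : Type u) [CommRing A] where
  /-- the ring `E_n^* = ⨁_q E_n^q` -/
  X : ℕ → Type u
  [ring : ∀ n, Ring (X n)]
  /-- the homogeneous component `E_n^q` -/
  deg : ∀ n : ℕ, ℕ → AddSubgroup (X n)
  [graded : ∀ n, GradedRing (deg n)]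
  /-- graded commutativity (antisymmetry) -/
  mul_comm_deg : ∀ {n p q : ℕ} {x y : X n}, x ∈ deg n p → y ∈ deg n q →
    x * y = (-1) ^ (p * q) * (y * x)
  level_zero : Subsingleton (X 0)
  /-- the restriction `R : E_{n+1}^* → E_n^*`, a map of graded rings -/
  R : ∀ n, X (n + 1) →+* X n
  R_deg : ∀ {n q : ℕ} {x : X (n + 1)}, x ∈ deg (n + 1) q → R n x ∈ deg n q
  /-- the map `λ : W_n(A) → E_n^0` -/
  lam : ∀ n, TwoWitt n A →+* X n
  lam_deg : ∀ (n : ℕ) (a : TwoWitt n A), lam n a ∈ deg n 0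
  R_lam : ∀ (n : ℕ) (a : TwoWitt (n + 1) A), R n (lam (n + 1) a) = lam n (TwoWitt.res n a)
  /-- the Frobenius `F : E_{n+1}^* → E_n^*`, a map of graded rings -/
  F : ∀ n, X (n + 1) →+* X n
  F_deg : ∀ {n q : ℕ} {x : X (n + 1)}, x ∈ deg (n + 1) q → F n x ∈ deg n q
  R_F : ∀ (n : ℕ) (x : X (n + 2)), R n (F (n + 1) x) = F n (R (n + 1) x)
  F_lam : ∀ (n : ℕ) (a : TwoWitt (n + 1) A), F n (lam (n + 1) a) = lam n (TwoWitt.frob n a)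
  /-- the Verschiebung `V : E_n^* → E_{n+1}^*` -/
  V : ∀ n, X n →+ X (n + 1)
  V_deg : ∀ {n q : ℕ} {x : X n}, x ∈ deg n q → V n x ∈ deg (n + 1) q
  R_V : ∀ (n : ℕ) (x : X (n + 1)), R (n + 1) (V (n + 1) x) = V n (R n x)
  V_lam : ∀ (n : ℕ) (a : TwoWitt n A), V n (lam n a) = lam (n + 1) (TwoWitt.ver n a)
  V_mul : ∀ (n : ℕ) (x : X n) (y : X (n + 1)), V n x * y = V n (x * F n y)
  /-- the derivation `d : E_n^q → E_n^{q+1}` -/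
  d : ∀ n, X n →+ X n
  d_deg : ∀ {n q : ℕ} {x : X n}, x ∈ deg n q → d n x ∈ deg n (q + 1)
  R_d : ∀ (n : ℕ) (x : X (n + 1)), R n (d (n + 1) x) = d n (R n x)
  d_mul : ∀ {n p : ℕ} {x : X n} (y : X n), x ∈ deg n p →
    d n (x * y) = d n x * y + (-1) ^ p * (x * d n y)

attribute [instance] PreWittComplex.ring PreWittComplex.graded

namespace PreWittComplex

variable {A : Type u} [CommRing A] (E : PreWittComplex A)

/-- The element `dλ([-1]_n) / λ([-1]_n)` of `E_n^1`; note that `[-1]_n` is its own inverse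
(`TwoWitt.teich_neg_one_mul_self`). -/
noncomputable def dlogNegOne (n : ℕ) : E.X n :=
  E.lam n (TwoWitt.teich n (-1)) * E.d n (E.lam n (TwoWitt.teich n (-1)))

/-- The operator `ι : E_n^q → E_n^{q+1}`: multiplication by `dλ([-1]_n) / λ([-1]_n)`. -/
noncomputable def iota (n : ℕ) (x : E.X n) : E.X n := E.dlogNegOne n * x

end PreWittComplex

/-- A 2-typical Witt complex over `A`. -/
structure WittComplex (A : Type u) [CommRing A] extends PreWittComplex A where
  F_V : ∀ (n : ℕ) (x : X n), F n (V n x) = 2 * x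
  F_d_V : ∀ (n : ℕ) (x : X n), F n (d (n + 1) (V n x)) = d n x + toPreWittComplex.iota n x
  d_d : ∀ (n : ℕ) (x : X n), d n (d n x) = d n (toPreWittComplex.iota n x)
  d_iota : ∀ (n : ℕ) (x : X n),
    d n (toPreWittComplex.iota n x) = toPreWittComplex.iota n (d n x)
  F_d_teich : ∀ (n : ℕ) (a : A),
    F n (d (n + 1) (lam (n + 1) (TwoWitt.teich (n + 1) a)))
      = lam n (TwoWitt.teich n a) * d n (lam n (TwoWitt.teich n a))

namespace WittComplex

variable {A : Type u} [CommRing A]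

/-- A map of 2-typical Witt complexes over `A`: a strict map of pro-graded rings commuting with
`λ`, `d`, `F` and `V`. -/
@[ext]
structure Hom (E E' : WittComplex A) where
  f : ∀ n, E.X n →+* E'.X n
  f_deg : ∀ {n q : ℕ} {x : E.X n}, x ∈ E.deg n q → f n x ∈ E'.deg n q
  f_R : ∀ (n : ℕ) (x : E.X (n + 1)), f n (E.R n x) = E'.R n (f (n + 1) x)
  f_lam : ∀ (n : ℕ) (a : TwoWitt n A), f n (E.lam n a) = E'.lam n a
  f_d : ∀ (n : ℕ) (x : E.X n), f n (E.d n x) = E'.d n (f n x)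
  f_F : ∀ (n : ℕ) (x : E.X (n + 1)), f n (E.F n x) = E'.F n (f (n + 1) x)
  f_V : ∀ (n : ℕ) (x : E.X n), f (n + 1) (E.V n x) = E'.V n (f n x)

/-- The category of 2-typical Witt complexes over `A`. Its initial object is, by definition, the
2-typical de Rham-Witt complex of `A`. -/
instance : Category (WittComplex A) where
  Hom := Hom
  id E :=
    { f := fun n => RingHom.id (E.X n)
      f_deg := fun h => h
      f_R := fun _ _ => rfl
      f_lam := fun _ _ => rfl
      f_d := fun _ _ => rfl
      f_F := fun _ _ => rfl
      f_V := fun _ _ => rfl }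
  comp g h :=
    { f := fun n => (h.f n).comp (g.f n)
      f_deg := fun hx => h.f_deg (g.f_deg hx)
      f_R := fun n x => by simp [g.f_R, h.f_R]
      f_lam := fun n x => by simp [g.f_lam, h.f_lam]
      f_d := fun n x => by simp [g.f_d, h.f_d]
      f_F := fun n x => by simp [g.f_F, h.f_F]
      f_V := fun n x => by simp [g.f_V, h.f_V] }

/-- The element `V^i(1) = V^i([1]_{n-i})` of `E_n^0`, for `i ≤ n` (and `0` for `i > n`; it is also
`0` for `i = n`, since level `0` is trivial). -/
def vOne (E : WittComplex A) : (n i : ℕ) → E.X n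
  | _, 0 => 1
  | 0, _ + 1 => 0
  | n + 1, i + 1 => E.V n (vOne E n i)

/-- The element `dV^i(1)` of `E_n^1`. -/
def dvOne (E : WittComplex A) (n i : ℕ) : E.X n := E.d n (E.vOne n i)

/-- The explicit description of a Witt complex `E` over `A` (used for `A = ℤ` and `A = ℤ_(2)`) in
terms of the elements `V^i(1)` and `dV^i(1)`. -/
structure HasExplicitStructure (E : WittComplex A) : Prop where
  /-- `λ : W_n(A) → E_n^0` is an isomorphism. -/
  lam_bijective : ∀ n : ℕ, Function.Injective (E.lam n) ∧ Set.range (E.lam n) = E.deg n 0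
  /-- `E_n^0 = ⨁_{i=0}^{n-1} A · V^i(1)`. -/
  deg_zero : ∀ n : ℕ, ∃ φ : (Fin n → A) ≃+ E.deg n 0,
    ∀ i : Fin n, (φ (Pi.single i 1) : E.X n) = E.vOne n i
  /-- `E_n^1 = ⨁_{i=1}^{n-1} ℤ/2^i · dV^i(1)`; the summand with index `i` here is the one that is
  generated by `dV^{i+1}(1)`. -/
  deg_one : ∀ n : ℕ, ∃ ψ : ((i : Fin (n - 1)) → ZMod (2 ^ (i.val + 1))) ≃+ E.deg n 1,
    ∀ i : Fin (n - 1), (ψ (Pi.single i 1) : E.X n) = E.dvOne n (i.val + 1)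
  /-- `E_n^q = 0` for `q ≥ 2`. -/
  deg_ge_two : ∀ n q : ℕ, 2 ≤ q → E.deg n q = ⊥
  /-- `V^i(1) V^j(1) = 2^i V^j(1)` for `i ≤ j`. -/
  vOne_mul_vOne : ∀ n i j : ℕ, i ≤ j → j < n → E.vOne n i * E.vOne n j = 2 ^ i • E.vOne n j
  /-- `V^i(1) dV^j(1) = 2^i dV^j(1) + ∑_{s=j+1}^{n-1} 2^{s-1} dV^s(1)` for `1 ≤ i < j`. -/
  vOne_mul_dvOne_of_lt : ∀ n i j : ℕ, 1 ≤ i → i < j → j < n →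
    E.vOne n i * E.dvOne n j
      = 2 ^ i • E.dvOne n j + ∑ s ∈ Finset.Ico (j + 1) n, 2 ^ (s - 1) • E.dvOne n s
  /-- `V^i(1) dV^j(1) = ∑_{s=i+1}^{n-1} 2^{s-1} dV^s(1)` for `1 ≤ j ≤ i`. -/
  vOne_mul_dvOne_of_le : ∀ n i j : ℕ, 1 ≤ j → j ≤ i → i < n →
    E.vOne n i * E.dvOne n j = ∑ s ∈ Finset.Ico (i + 1) n, 2 ^ (s - 1) • E.dvOne n s
  /-- `V(V^i(1)) = V^{i+1}(1)`. -/
  V_vOne : ∀ n i : ℕ, i < n → E.V n (E.vOne n i) = E.vOne (n + 1) (i + 1)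
  /-- `V(dV^i(1)) = 2 dV^{i+1}(1)`. -/
  V_dvOne : ∀ n i : ℕ, 1 ≤ i → i < n → E.V n (E.dvOne n i) = 2 • E.dvOne (n + 1) (i + 1)
  /-- `F(V^{i+1}(1)) = 2 V^i(1)` for `F` from level `n + 1` to level `n`. -/
  F_vOne : ∀ n i : ℕ, i < n → E.F n (E.vOne (n + 1) (i + 1)) = 2 • E.vOne n i
  /-- `F(dV^{i+1}(1)) = dV^i(1) + ∑_{s=i+1}^{n-1} 2^{s-1} dV^s(1)` for `F` from level `n + 1` to
  level `n`. -/
  F_dvOne : ∀ n i : ℕ, i < n →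
    E.F n (E.dvOne (n + 1) (i + 1))
      = E.dvOne n i + ∑ s ∈ Finset.Ico (i + 1) n, 2 ^ (s - 1) • E.dvOne n s
  /-- `d(1) = 0`; for `i ≥ 1` the image of `V^i(1)` under `d` is `dV^i(1)` by definition. -/
  d_one : ∀ n : ℕ, E.d n 1 = 0
  /-- `ι(V^i(1)) = ∑_{s=i+1}^{n-1} 2^{s-1} dV^s(1)`. -/
  iota_vOne : ∀ n i : ℕ, i < n →
    E.iota n (E.vOne n i) = ∑ s ∈ Finset.Ico (i + 1) n, 2 ^ (s - 1) • E.dvOne n s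
  /-- The restriction from level `n + 1` to level `n` fixes `V^i(1)` for `i < n`, … -/
  R_vOne : ∀ n i : ℕ, i < n → E.R n (E.vOne (n + 1) i) = E.vOne n i
  /-- … kills `V^n(1)`, … -/
  R_vOne_self : ∀ n : ℕ, E.R n (E.vOne (n + 1) n) = 0
  /-- … fixes `dV^i(1)` for `1 ≤ i < n`, … -/
  R_dvOne : ∀ n i : ℕ, 1 ≤ i → i < n → E.R n (E.dvOne (n + 1) i) = E.dvOne n i
  /-- … and kills `dV^n(1)`. -/
  R_dvOne_self : ∀ n : ℕ, 1 ≤ n → E.R n (E.dvOne (n + 1) n) = 0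

end WittComplex

instance span_two_isPrime : (Ideal.span {(2 : ℤ)}).IsPrime :=
  (Ideal.span_singleton_prime two_ne_zero).mpr Int.prime_two

/-- The ring `ℤ_(2)`, the localization of `ℤ` at the prime ideal `(2)`. -/
abbrev ZLocTwo : Type := Localization.AtPrime (Ideal.span {(2 : ℤ)})

/-! Write `δ` for `dlog [-1]`. In every Witt complex the operators and products of the elements
`V^i(1)` and `dV^i(1)` are forced. Since `[-1] = -1 + V(1)` and `[-1]^2 = 1`, one gets `2δ = 0`,
`V(δ) = δ + dV(1)` and `F(δ) = δ`. The Leibniz rule for `V(1)V(x) = 2V(x)` gives `Vd = 2dV` in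
degree zero (`V_d`), hence `2^i dV^i(1) = 0`. Induction on the level yields `δ = ∑ 2^(s-1) dV^s(1)`,
and `V(x)y = V(xF(y))` then gives all products (`vOne_mul_dvOne`). Differentiating these shows that
`dV^i(1) dV^j(1)` and `ddV^i(1)` vanish.

That no further relations hold is shown by a model. As `2` is regular and `a^2 ≡ a` modulo `2`, the
ghost components satisfy `w_{j+1} ≡ w_j` modulo `2^(j+1)`, and the coordinates `w_0`, `(w_{j+1} -
w_j)/2^(j+1)` identify `W_n(A)` with `A^n`, the elements `V^i(1)` becoming the standard basis.
Degree one of the model is a product of groups `ℤ/2^(j+1)`, and `d` reduces the coordinates. A Witt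
vector `x` acts on `m` through `w_{j+1}(x)`, plus the correction `2^j τ_j(dx) τ_j(m)`, where `τ_j`
is the parity of the sum of the first `j` components; this correction produces the tails in the
product formula. The square-zero extension is formed in the limit over `n` and cut down by the
ideals `fil n`.

Odd integers invertible in `A` act invertibly on any Witt complex, so additive maps out of the model
are determined on generators. There the universal relations agree with the model, which is therefore
initial (`Drw.isInitial`); its bases are transported to any initial object. -/

/-- A ring lying between `ℤ` and `ℤ_(2)`: `2` is regular, every element is a fraction with odd
invertible denominator, and there are reductions modulo the powers of `2`. -/
class TwoIntegral (A : Type u) [CommRing A] where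
  two_mul_eq_zero : ∀ a : A, 2 * a = 0 → a = 0
  proj : ∀ k : ℕ, A →+* ZMod (2 ^ k)
  exists_frac : ∀ a : A, ∃ p q : ℤ, Odd q ∧ IsUnit (q : A) ∧ (q : A) * a = p

/-! ### Arithmetic modulo powers of `2` in `ℤ` and `ℤ_(2)` -/

namespace TwoIntegral

instance : TwoIntegral ℤ where
  two_mul_eq_zero a h := by omega
  proj k := Int.castRingHom _
  exists_frac a := ⟨a, 1, odd_one, by simp, by simp⟩

theorem isUnit_intCast_zmod {q : ℤ} (hq : Odd q) (k : ℕ) : IsUnit (q : ZMod (2 ^ k)) := by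
  rw [ZMod.coe_int_isUnit_iff_isCoprime]
  push_cast
  apply IsCoprime.pow_left
  rw [Int.isCoprime_iff_gcd_eq_one, Int.gcd_comm, ← Int.isCoprime_iff_gcd_eq_one]
  obtain ⟨m, rfl⟩ := hq
  exact ⟨1, -m, by ring⟩

theorem odd_of_not_mem_span_two {q : ℤ} (h : q ∈ (Ideal.span {(2 : ℤ)}).primeCompl) : Odd q := by
  rw [← Int.not_even_iff_odd]
  intro he
  exact h (Ideal.mem_span_singleton.mpr he.two_dvd)

noncomputable instance : TwoIntegral ZLocTwo where
  two_mul_eq_zero a h := by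
    have : IsDomain ZLocTwo :=
      IsLocalization.isDomain_localization (Ideal.primeCompl_le_nonZeroDivisors _)
    have : CharZero ZLocTwo := charZero_of_injective_algebraMap
      (IsLocalization.injective ZLocTwo
        (Ideal.primeCompl_le_nonZeroDivisors (Ideal.span {(2 : ℤ)})))
    simpa using h
  proj k := IsLocalization.lift (M := (Ideal.span {(2 : ℤ)}).primeCompl)
    (g := Int.castRingHom (ZMod (2 ^ k)))
    (fun y => isUnit_intCast_zmod (odd_of_not_mem_span_two y.2) k)
  exists_frac a := by
    obtain ⟨⟨p, q⟩, h⟩ := IsLocalization.surj (Ideal.span {(2 : ℤ)}).primeCompl a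
    have hu := IsLocalization.map_units ZLocTwo q
    simp only [eq_intCast] at h hu
    exact ⟨p, q, odd_of_not_mem_span_two q.2, hu, by rw [mul_comm, h]⟩

variable {A : Type u} [CommRing A] [TwoIntegral A]

theorem two_pow_mul_cancel (k : ℕ) {a b : A} (h : 2 ^ k * a = 2 ^ k * b) : a = b := by
  induction k with
  | zero => simpa using h
  | succ k ih =>
    apply ih
    rw [← sub_eq_zero]
    apply two_mul_eq_zero
    rw [mul_sub, sub_eq_zero]
    linear_combination h

/-- For `a = p/q` with `q` odd, `q^2 (a^2 - a) = p(p - q)`, and one of the two factors is even; the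
unit `q^2` is then cancelled. This is the source of all congruences between ghost components. -/
theorem two_dvd_sq_sub (a : A) : (2 : A) ∣ a ^ 2 - a := by
  obtain ⟨p, q, hq, hu, h⟩ := exists_frac a
  have h2 : (2 : ℤ) ∣ p * (p - q) := by
    rcases Int.even_or_odd p with hp | hp
    · exact hp.two_dvd.mul_right _
    · exact (hp.sub_odd hq).two_dvd.mul_left _
  obtain ⟨c, hc⟩ := h2
  have : (q : A) ^ 2 * (a ^ 2 - a) = 2 * c := by
    have : ((p * (p - q) : ℤ) : A) = ((2 * c : ℤ) : A) := by rw [hc]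
    push_cast at this
    rw [← this, ← h]
    ring
  rw [← (hu.pow 2).dvd_mul_left, this]
  exact dvd_mul_right _ _

theorem two_pow_dvd_pow_sub_pow (a : A) (m : ℕ) :
    (2 : A) ^ (m + 1) ∣ a ^ 2 ^ (m + 1) - a ^ 2 ^ m := by
  have := dvd_sub_pow_of_dvd_sub (R := A) (p := 2) (a := a ^ 2) (b := a)
    (by exact_mod_cast two_dvd_sq_sub a) m
  rwa [← pow_mul, ← pow_succ'] at this

end TwoIntegral

/-! ### Ghost components, their congruences and the ghost coordinates -/

namespace WittVector

open TwoIntegral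

variable {A : Type u} [CommRing A]

theorem ghostComponent_two_eq_sum (n : ℕ) (x : WittVector 2 A) :
    ghostComponent n x = ∑ k ∈ Finset.range (n + 1), 2 ^ k * x.coeff k ^ 2 ^ (n - k) := by
  rw [ghostComponent_apply, wittPolynomial_eq_sum_C_mul_X_pow]
  simp

theorem ghostComponent_two_zero (x : WittVector 2 A) : ghostComponent 0 x = x.coeff 0 := by
  simp [ghostComponent_two_eq_sum]

theorem ghostComponent_eq_zero_of_coeff {n : ℕ} {x : WittVector 2 A}
    (h : ∀ i < n, x.coeff i = 0) {i : ℕ} (hi : i < n) : ghostComponent i x = 0 := by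
  rw [ghostComponent_two_eq_sum]
  refine Finset.sum_eq_zero fun k hk => ?_
  rw [h k (by have := Finset.mem_range.mp hk; omega), zero_pow (by positivity), mul_zero]

theorem ghostComponent_iterate_verschiebung_of_lt (i : ℕ) (x : WittVector 2 A) {j : ℕ}
    (h : j < i) : ghostComponent j (verschiebung^[i] x) = 0 :=
  ghostComponent_eq_zero_of_coeff
    (fun _ hk => iterate_verschiebung_coeff_eq_zero _ hk) h

theorem ghostComponent_iterate_verschiebung (i : ℕ) (x : WittVector 2 A) (j : ℕ) :
    ghostComponent (j + i) (verschiebung^[i] x) = 2 ^ i * ghostComponent j x := by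
  induction i with
  | zero => simp
  | succ i ih =>
    rw [Function.iterate_succ_apply', ← add_assoc, ghostComponent_verschiebung, ih]
    push_cast
    ring

theorem ghostComponent_iterate_verschiebung_one (i j : ℕ) :
    ghostComponent j (verschiebung^[i] (1 : WittVector 2 A)) = if i ≤ j then 2 ^ i else 0 := by
  split_ifs with h
  · obtain ⟨m, rfl⟩ := Nat.exists_eq_add_of_le' h
    rw [ghostComponent_iterate_verschiebung, map_one, mul_one]
  · exact ghostComponent_iterate_verschiebung_of_lt _ _ (by omega)

variable [TwoIntegral A]

/-- Once the lower coefficients vanish, `w_i = 2^i x_i`, and `2` is regular. -/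
theorem coeff_eq_zero_of_ghostComponent {n : ℕ} {x : WittVector 2 A}
    (h : ∀ i < n, ghostComponent i x = 0) : ∀ i < n, x.coeff i = 0 := by
  intro i
  induction i using Nat.strong_induction_on with
  | _ i ih =>
    intro hi
    have h0 := h i hi
    rw [ghostComponent_two_eq_sum, Finset.sum_range_succ, Finset.sum_eq_zero, zero_add] at h0
    · apply two_pow_mul_cancel i
      simpa using h0
    · intro k hk
      have hk := Finset.mem_range.mp hk
      rw [ih k hk (by omega), zero_pow (by positivity), mul_zero]

theorem eq_of_ghostComponent {x y : WittVector 2 A}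
    (h : ∀ i, ghostComponent i x = ghostComponent i y) : x = y := by
  rw [← sub_eq_zero]
  ext i
  rw [zero_coeff]
  exact coeff_eq_zero_of_ghostComponent (n := i + 1)
    (fun i _ => by rw [map_sub, h, sub_self]) i (by omega)

/-- Dwork's congruence: the `k`-th terms differ by `2^k` times a multiple of `2^(j-k+1)`, and the
one new term carries the factor `2^(j+1)`. -/
theorem two_pow_dvd_ghostComponent_sub (x : WittVector 2 A) (j : ℕ) :
    (2 : A) ^ (j + 1) ∣ ghostComponent (j + 1) x - ghostComponent j x := by
  rw [ghostComponent_two_eq_sum, ghostComponent_two_eq_sum, Finset.sum_range_succ,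
    add_sub_right_comm, ← Finset.sum_sub_distrib]
  refine dvd_add (Finset.dvd_sum fun k hk => ?_) (dvd_mul_right _ _)
  obtain ⟨m, rfl⟩ := Nat.exists_eq_add_of_le (Nat.lt_succ_iff.mp (Finset.mem_range.mp hk))
  rw [← mul_sub, show k + m + 1 - k = m + 1 by omega, show k + m - k = m by omega, add_assoc,
    pow_add]
  exact mul_dvd_mul_left _ (two_pow_dvd_pow_sub_pow _ _)

/-- The divided difference `(w_{j+1} - w_j) / 2 ^ (j + 1)` of ghost components. -/
noncomputable def ghostDiff (j : ℕ) : WittVector 2 A →+ A where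
  toFun x := (two_pow_dvd_ghostComponent_sub x j).choose
  map_zero' := two_pow_mul_cancel (j + 1) <| by
    rw [← (two_pow_dvd_ghostComponent_sub (0 : WittVector 2 A) j).choose_spec]
    simp
  map_add' x y := two_pow_mul_cancel (j + 1) <| by
    rw [mul_add, ← (two_pow_dvd_ghostComponent_sub x j).choose_spec,
      ← (two_pow_dvd_ghostComponent_sub y j).choose_spec,
      ← (two_pow_dvd_ghostComponent_sub (x + y) j).choose_spec, map_add, map_add]
    ring

theorem two_pow_mul_ghostDiff (j : ℕ) (x : WittVector 2 A) :
    2 ^ (j + 1) * ghostDiff j x = ghostComponent (j + 1) x - ghostComponent j x :=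
  (two_pow_dvd_ghostComponent_sub x j).choose_spec.symm

theorem ghostDiff_eq {j : ℕ} {x : WittVector 2 A} {a : A}
    (h : ghostComponent (j + 1) x - ghostComponent j x = 2 ^ (j + 1) * a) : ghostDiff j x = a :=
  two_pow_mul_cancel (j + 1) (by rw [two_pow_mul_ghostDiff, h])

/-- The coordinates `w_0, (w_1 - w_0) / 2, (w_2 - w_1) / 4, …` of a Witt vector. -/
noncomputable def ghostCoord : ℕ → WittVector 2 A →+ A
  | 0 => (ghostComponent 0 : WittVector 2 A →+* A)
  | j + 1 => ghostDiff j

theorem ghostComponent_eq_zero_of_ghostCoord {n : ℕ} {x : WittVector 2 A}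
    (h : ∀ i < n, ghostCoord i x = 0) : ∀ i < n, ghostComponent i x = 0 := by
  intro i
  induction i with
  | zero => exact fun hi => h 0 hi
  | succ i ih =>
    intro hi
    have h1 := two_pow_mul_ghostDiff i x
    rw [show ghostDiff i x = 0 from h (i + 1) hi, ih (by omega)] at h1
    simpa using h1.symm

theorem ghostCoord_eq_zero_of_ghostComponent {n : ℕ} {x : WittVector 2 A}
    (h : ∀ i < n, ghostComponent i x = 0) : ∀ i < n, ghostCoord i x = 0 := by
  rintro (_ | i) hi
  · exact h 0 hi
  · exact ghostDiff_eq (by rw [h (i + 1) hi, h i (by omega)]; simp)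

theorem truncate_eq_zero_iff_ghostComponent {n : ℕ} {x : WittVector 2 A} :
    truncate n x = 0 ↔ ∀ i < n, ghostComponent i x = 0 := by
  rw [← RingHom.mem_ker, mem_ker_truncate]
  exact ⟨fun h i hi => ghostComponent_eq_zero_of_coeff h hi, coeff_eq_zero_of_ghostComponent⟩

theorem truncate_eq_zero_iff_ghostCoord {n : ℕ} {x : WittVector 2 A} :
    truncate n x = 0 ↔ ∀ i < n, ghostCoord i x = 0 := by
  rw [truncate_eq_zero_iff_ghostComponent]
  exact ⟨ghostCoord_eq_zero_of_ghostComponent, ghostComponent_eq_zero_of_ghostCoord⟩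

theorem ghostCoord_iterate_verschiebung_of_lt (n : ℕ) (x : WittVector 2 A) {i : ℕ}
    (hi : i < n) : ghostCoord i (verschiebung^[n] x) = 0 :=
  ghostCoord_eq_zero_of_ghostComponent
    (fun _ h => ghostComponent_iterate_verschiebung_of_lt n x h) i hi

theorem ghostCoord_iterate_verschiebung_self (n : ℕ) (x : WittVector 2 A) :
    ghostCoord n (verschiebung^[n] x) = x.coeff 0 := by
  cases n with
  | zero => exact ghostComponent_two_zero x
  | succ n =>
    apply ghostDiff_eq
    have := ghostComponent_iterate_verschiebung (n + 1) x 0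
    rw [zero_add] at this
    rw [this, ghostComponent_iterate_verschiebung_of_lt _ _ (Nat.lt_succ_self n),
      ghostComponent_two_zero, sub_zero]

/-- Adding `V^n[c]` leaves the coordinates below `n` alone and shifts the `n`-th one by `c`, so the
coordinates can be adjusted one after the other. -/
theorem exists_ghostCoord_eq (c : ℕ → A) (n : ℕ) :
    ∃ x : WittVector 2 A, ∀ i < n, ghostCoord i x = c i := by
  induction n with
  | zero => exact ⟨0, by simp⟩
  | succ n ih =>
    obtain ⟨x, hx⟩ := ih
    refine ⟨x + verschiebung^[n] (teichmuller 2 (c n - ghostCoord n x)), fun i hi => ?_⟩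
    rw [map_add]
    rcases Nat.lt_succ_iff_lt_or_eq.mp hi with hi | rfl
    · rw [ghostCoord_iterate_verschiebung_of_lt _ _ hi, hx i hi, add_zero]
    · rw [ghostCoord_iterate_verschiebung_self, teichmuller_coeff_zero]
      ring

/-- The ghost vector of `V^i(1)` is `(0, …, 0, 2^i, 2^i, …)`; for `i ≥ 1` its only jump is `2^i`, at
index `i`. -/
theorem ghostDiff_iterate_verschiebung_one (i j : ℕ) :
    ghostDiff j (verschiebung^[i] (1 : WittVector 2 A)) = if i = j + 1 then 1 else 0 := by
  apply ghostDiff_eq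
  rw [ghostComponent_iterate_verschiebung_one, ghostComponent_iterate_verschiebung_one]
  split_ifs with h1 h2 h3 h4 h5
  all_goals first | omega | simp [*]

theorem ghostCoord_iterate_verschiebung_one (i j : ℕ) :
    ghostCoord j (verschiebung^[i] (1 : WittVector 2 A)) = if i = j then 1 else 0 := by
  cases j with
  | zero =>
    refine (ghostComponent_iterate_verschiebung_one i 0).trans ?_
    rcases i with _ | i <;> simp
  | succ j => exact ghostDiff_iterate_verschiebung_one i j

/-- Ghost coordinates are additive, so the vector with coordinates `(q⁻¹, 0, 0, …)` is an inverse of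
`q` in `W_n(A)`. Hence `q` is invertible in every `W_n(A)`-algebra. -/
theorem exists_intCast_mul_truncate_eq_one {q : ℤ} (hq : IsUnit (q : A)) (n : ℕ) :
    ∃ u : TruncatedWittVector 2 n A, (q : TruncatedWittVector 2 n A) * u = 1 := by
  obtain ⟨b, hb⟩ := hq.exists_right_inv
  obtain ⟨x, hx⟩ := exists_ghostCoord_eq (fun i => if i = 0 then b else 0) n
  refine ⟨truncate n x, ?_⟩
  rw [← map_intCast (truncate n : WittVector 2 A →+* _), ← map_mul, ← sub_eq_zero,
    ← map_one (truncate n : WittVector 2 A →+* _), ← map_sub, truncate_eq_zero_iff_ghostCoord]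
  intro i hi
  have h1 := ghostCoord_iterate_verschiebung_one (A := A) 0 i
  rw [Function.iterate_zero_apply] at h1
  rw [map_sub, ← zsmul_eq_mul, map_zsmul, hx i hi, h1]
  split_ifs with h h' h'
  · rw [zsmul_eq_mul, hb, sub_self]
  · omega
  · omega
  · simp

/-- Additive maps out of `W_n(A)` that agree on the elements `V^i(1)` are equal, provided that
the odd integers that are invertible in `A` act injectively on the target. -/
theorem eq_of_eq_iterate_verschiebung_one {N : Type*} [AddCommGroup N] (n : ℕ)
    (hN : ∀ (q : ℤ) (y : N), IsUnit (q : A) → q • y = 0 → y = 0)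
    (f g : WittVector 2 A →+ N) (hf : ∀ x, truncate n x = 0 → f x = 0)
    (hg : ∀ x, truncate n x = 0 → g x = 0)
    (h : ∀ i < n, f (verschiebung^[i] 1) = g (verschiebung^[i] 1)) : f = g := by
  -- Descent along the filtration by vanishing of the first coordinates: `k` counts the coordinates
  -- below `n` that are still free.
  suffices H : ∀ k ≤ n, ∀ x : WittVector 2 A, (∀ i < n - k, ghostCoord i x = 0) → f x = g x by
    ext x
    exact H n le_rfl x (by simp)
  intro k
  induction k with
  | zero =>
    intro _ x hx
    have := truncate_eq_zero_iff_ghostCoord.mpr hx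
    rw [Nat.sub_zero] at this
    rw [hf x this, hg x this]
  | succ k ih =>
    intro hk x hx
    obtain ⟨p, q, -, hu, hpq⟩ := exists_frac (ghostCoord (n - (k + 1)) x)
    -- With leading coordinate `p/q`, the combination `q x - p V^(n-k-1)(1)` lies one step deeper;
    -- `q` is cancelled in `N` at the end.
    have h1 := ih (by omega) (q • x - p • verschiebung^[n - (k + 1)] 1) (fun i hi => by
      rw [map_sub, map_zsmul, map_zsmul, ghostCoord_iterate_verschiebung_one]
      rcases Nat.lt_or_ge i (n - (k + 1)) with hi' | hi'
      · rw [hx i hi', if_neg (by omega)]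
        simp
      · obtain rfl : i = n - (k + 1) := by omega
        rw [zsmul_eq_mul, hpq]
        simp)
    rw [map_sub, map_sub, map_zsmul, map_zsmul, map_zsmul, map_zsmul, h _ (by omega),
      sub_left_inj, ← sub_eq_zero, ← zsmul_sub] at h1
    exact sub_eq_zero.mp (hN q _ hu h1)

theorem teichmuller_neg_one {B : Type*} [CommRing B] :
    teichmuller 2 (-1 : B) = -1 + verschiebung 1 := by
  -- Over `ℤ` both sides have ghost vector `(-1, 1, 1, …)`; the general case follows by
  -- functoriality along `ℤ → B`.
  have h : teichmuller 2 (-1 : ℤ) = -1 + verschiebung 1 := by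
    apply eq_of_ghostComponent
    rintro (_ | i)
    · rw [ghostComponent_teichmuller, map_add, ghostComponent_zero_verschiebung]
      simp
    · rw [ghostComponent_teichmuller, map_add, ghostComponent_verschiebung]
      rw [pow_succ', pow_mul]
      norm_num
  have := congrArg (map (Int.castRingHom B)) h
  rw [map_teichmuller, map_add, map_verschiebung] at this
  simpa only [map_neg, map_one] using this

end WittVector

/-! ### Truncated operators computed on arbitrary lifts -/

namespace TwoWitt

variable {A : Type u} [CommRing A]

theorem ver_truncate (n : ℕ) (x : WittVector 2 A) :
    ver n (WittVector.truncate n x)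
      = WittVector.truncate (n + 1) (WittVector.verschiebung x) := by
  have h : WittVector.truncate n (TruncatedWittVector.out (WittVector.truncate n x) - x) = 0 := by
    rw [map_sub, sub_eq_zero]
    exact TruncatedWittVector.truncateFun_out _
  rw [← RingHom.mem_ker, WittVector.mem_ker_truncate] at h
  rw [ver, ← sub_eq_zero, ← map_sub, ← map_sub, ← RingHom.mem_ker, WittVector.mem_ker_truncate]
  rintro (_ | i) hi
  · exact WittVector.verschiebung_coeff_zero _
  · rw [WittVector.verschiebung_coeff_succ]
    exact h i (by omega)

theorem res_truncate (n : ℕ) (x : WittVector 2 A) :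
    res n (WittVector.truncate (n + 1) x) = WittVector.truncate n x :=
  TruncatedWittVector.truncate_wittVector_truncate _ _

end TwoWitt

namespace WittComplex

variable {A : Type u} [CommRing A] (E : WittComplex A)

/-! ### Relations that hold in every Witt complex -/

theorem vOne_zero (n : ℕ) : E.vOne n 0 = 1 := by
  cases n <;> rfl

theorem vOne_succ (n i : ℕ) : E.vOne (n + 1) (i + 1) = E.V n (E.vOne n i) := rfl

theorem vOne_eq_zero {n i : ℕ} (h : n ≤ i) : E.vOne n i = 0 := by
  induction n generalizing i with
  | zero => exact @Subsingleton.elim _ E.level_zero _ _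
  | succ n ih =>
    obtain ⟨i, rfl⟩ := Nat.exists_eq_succ_of_ne_zero (show i ≠ 0 by omega)
    rw [vOne_succ, ih (by omega), map_zero]

theorem dvOne_eq_zero {n i : ℕ} (h : n ≤ i) : E.dvOne n i = 0 := by
  rw [dvOne, vOne_eq_zero E h, map_zero]

theorem vOne_mem (n i : ℕ) : E.vOne n i ∈ E.deg n 0 := by
  induction n generalizing i with
  | zero => rw [@Subsingleton.elim _ E.level_zero (E.vOne 0 i) 0]; exact zero_mem _
  | succ n ih =>
    cases i with
    | zero => exact SetLike.one_mem_graded _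
    | succ i => exact E.V_deg (ih i)

theorem dvOne_mem (n i : ℕ) : E.dvOne n i ∈ E.deg n 1 := E.d_deg (E.vOne_mem n i)

theorem d_mul_zero {n : ℕ} {x : E.X n} (y : E.X n) (hx : x ∈ E.deg n 0) :
    E.d n (x * y) = E.d n x * y + x * E.d n y := by
  simpa using E.d_mul y hx

theorem d_one_eq_zero (n : ℕ) : E.d n 1 = 0 := by
  simpa using E.d_mul_zero (1 : E.X n) (SetLike.one_mem_graded (E.deg n))

theorem commute_of_mem {n q : ℕ} {x y : E.X n} (hx : x ∈ E.deg n 0) (hy : y ∈ E.deg n q) :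
    x * y = y * x := by
  simpa using E.mul_comm_deg hx hy

theorem dvOne_zero (n : ℕ) : E.dvOne n 0 = 0 := by
  rw [dvOne, vOne_zero, d_one_eq_zero]

theorem dlogNegOne_mem (n : ℕ) : E.dlogNegOne n ∈ E.deg n 1 := by
  have := SetLike.mul_mem_graded (E.lam_deg n (TwoWitt.teich n (-1)))
    (E.d_deg (E.lam_deg n (TwoWitt.teich n (-1))))
  rwa [zero_add] at this

theorem lam_teich_neg_one (n : ℕ) : E.lam n (TwoWitt.teich n (-1)) = -1 + E.vOne n 1 := by
  cases n with
  | zero => exact @Subsingleton.elim _ E.level_zero _ _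
  | succ n =>
    rw [vOne_succ, vOne_zero, ← map_one (E.lam n), E.V_lam, ← map_one (E.lam (n + 1)), ← map_neg,
      ← map_add, TwoWitt.teich, WittVector.teichmuller_neg_one, map_add, map_neg, map_one]
    rw [← map_one (WittVector.truncate n : WittVector 2 A →+* _), TwoWitt.ver_truncate]

theorem dlogNegOne_eq (n : ℕ) :
    E.dlogNegOne n = -E.dvOne n 1 + E.vOne n 1 * E.dvOne n 1 := by
  rw [PreWittComplex.dlogNegOne, lam_teich_neg_one, map_add, map_neg, d_one_eq_zero, neg_zero,
    zero_add, add_mul, neg_one_mul]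
  rfl

/-- Differentiate `[-1]^2 = 1`. -/
theorem two_nsmul_dlogNegOne (n : ℕ) : 2 • E.dlogNegOne n = 0 := by
  have h1 := E.d_mul_zero (E.lam n (TwoWitt.teich n (-1))) (E.lam_deg n (TwoWitt.teich n (-1)))
  rw [← map_mul, TwoWitt.teich_neg_one_mul_self, map_one, d_one_eq_zero,
    ← E.commute_of_mem (E.lam_deg n _) (E.d_deg (E.lam_deg n _))] at h1
  rw [two_nsmul]
  exact h1.symm

/-- `V(1) dV(1) = V(FdV(1)) = V(δ)`, because `FdV(1) = d(1) + ι(1) = δ`; this is inserted into `δ =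
-dV(1) + V(1) dV(1)`. -/
theorem V_dlogNegOne (n : ℕ) :
    E.V n (E.dlogNegOne n) = E.dlogNegOne (n + 1) + E.dvOne (n + 1) 1 := by
  have h : E.vOne (n + 1) 1 * E.dvOne (n + 1) 1 = E.V n (E.dlogNegOne n) := by
    rw [vOne_succ, vOne_zero, E.V_mul, one_mul, dvOne, vOne_succ, vOne_zero, E.F_d_V,
      d_one_eq_zero, zero_add, PreWittComplex.iota, mul_one]
  rw [E.dlogNegOne_eq (n + 1), h]
  abel

/-- Apply `F` to `δ = V(δ) - dV(1)`: the result is `2δ - δ`. -/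
theorem F_dlogNegOne (n : ℕ) : E.F n (E.dlogNegOne (n + 1)) = E.dlogNegOne n := by
  rw [← add_sub_cancel_right (E.dlogNegOne (n + 1)) (E.dvOne (n + 1) 1), ← V_dlogNegOne, map_sub,
    E.F_V, dvOne, vOne_succ, vOne_zero, E.F_d_V, d_one_eq_zero, zero_add, PreWittComplex.iota,
    mul_one, two_mul, add_sub_cancel_right]

/-- Differentiate `V(1)V(x) = 2V(x)`. Both terms of the Leibniz rule contribute `V(δx)`, and these
cancel because `2δ = 0`. -/
theorem V_d {n : ℕ} {x : E.X n} (hx : x ∈ E.deg n 0) :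
    E.V n (E.d n x) = 2 • E.d (n + 1) (E.V n x) := by
  have h1 : E.V n 1 * E.V n x = 2 • E.V n x := by
    rw [E.V_mul, one_mul, E.F_V, ← map_nsmul, nsmul_eq_mul, Nat.cast_ofNat]
  have h2 : E.d (n + 1) (E.V n 1) * E.V n x = E.V n (E.dlogNegOne n * x) := by
    rw [← E.commute_of_mem (E.V_deg hx)
      (E.d_deg (E.V_deg (SetLike.one_mem_graded (E.deg n)))), E.V_mul, E.F_d_V, d_one_eq_zero,
      zero_add, PreWittComplex.iota, mul_one, E.commute_of_mem hx (E.dlogNegOne_mem n)]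
  have h3 : E.V n 1 * E.d (n + 1) (E.V n x) = E.V n (E.d n x) + E.V n (E.dlogNegOne n * x) := by
    rw [E.V_mul, one_mul, E.F_d_V, map_add, PreWittComplex.iota]
  have h4 := E.d_mul_zero (E.V n x) (E.V_deg (SetLike.one_mem_graded (E.deg n)))
  rw [h1, h2, h3, map_nsmul, add_left_comm, ← map_add, ← two_nsmul, ← smul_mul_assoc,
    two_nsmul_dlogNegOne, zero_mul, map_zero, add_zero] at h4
  exact h4.symm

theorem V_dvOne_eq (n i : ℕ) : E.V n (E.dvOne n i) = 2 • E.dvOne (n + 1) (i + 1) :=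
  E.V_d (E.vOne_mem n i)

theorem two_pow_nsmul_dvOne (n i : ℕ) : 2 ^ i • E.dvOne n i = 0 := by
  induction n generalizing i with
  | zero => exact @Subsingleton.elim _ E.level_zero _ _
  | succ n ih =>
    cases i with
    | zero => rw [dvOne_zero, smul_zero]
    | succ i => rw [pow_succ, mul_nsmul', ← V_dvOne_eq, ← map_nsmul, ih, map_zero]

theorem two_pow_nsmul_dvOne_of_le (n : ℕ) {i k : ℕ} (h : i ≤ k) :
    2 ^ k • E.dvOne n i = 0 := by
  obtain ⟨m, rfl⟩ := Nat.exists_eq_add_of_le h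
  rw [pow_add, mul_comm, mul_nsmul', two_pow_nsmul_dvOne, smul_zero]

/-- The element `∑_{s=k+1}^{n-1} 2^{s-1} dV^s(1)`. -/
def dvTail (n k : ℕ) : E.X n := ∑ s ∈ Finset.Ico (k + 1) n, 2 ^ (s - 1) • E.dvOne n s

theorem V_dvTail (n k : ℕ) : E.V n (E.dvTail n k) = E.dvTail (n + 1) (k + 1) := by
  rw [dvTail, dvTail, map_sum, ← Finset.sum_Ico_add']
  refine Finset.sum_congr rfl fun s hs => ?_
  have := (Finset.mem_Ico.mp hs).1
  rw [map_nsmul, V_dvOne_eq, ← mul_nsmul', ← pow_succ, Nat.sub_add_cancel (by omega),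
    Nat.add_sub_cancel]

theorem dvTail_eq_add (n k : ℕ) :
    E.dvTail n k = 2 ^ k • E.dvOne n (k + 1) + E.dvTail n (k + 1) := by
  rcases Nat.lt_or_ge (k + 1) n with h | h
  · rw [dvTail, Finset.sum_eq_sum_Ico_succ_bot h, Nat.add_sub_cancel]
    rfl
  · rw [dvTail, dvTail, Finset.Ico_eq_empty (by omega), Finset.Ico_eq_empty (by omega),
      dvOne_eq_zero E h, Finset.sum_empty, smul_zero, zero_add]

/-- Solve `V(δ) = δ + dV(1)` for `δ` at the next level; the sign of `dV(1)` is irrelevant since `2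
dV(1) = 0`. -/
theorem dlogNegOne_eq_dvTail (n : ℕ) : E.dlogNegOne n = E.dvTail n 0 := by
  induction n with
  | zero => exact @Subsingleton.elim _ E.level_zero _ _
  | succ n ih =>
    have h := E.V_dlogNegOne n
    have h2 := E.two_pow_nsmul_dvOne (n + 1) 1
    rw [ih, V_dvTail] at h
    rw [dvTail_eq_add, h, pow_zero, one_smul, add_left_comm, ← two_nsmul]
    rw [pow_one] at h2
    rw [h2, add_zero]

theorem two_nsmul_dvTail (n k : ℕ) : 2 • E.dvTail n k = 0 := by
  rw [dvTail, Finset.smul_sum]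
  refine Finset.sum_eq_zero fun s hs => ?_
  have := (Finset.mem_Ico.mp hs).1
  rw [← mul_nsmul', ← pow_succ', Nat.sub_add_cancel (by omega), two_pow_nsmul_dvOne]

/-- Since `F(δ) = δ`, multiplication by `δ` commutes with `V` on the elements `V^i(1)`, which
reduces to `i = 0`. -/
theorem dlogNegOne_mul_vOne (n i : ℕ) : E.dlogNegOne n * E.vOne n i = E.dvTail n i := by
  induction n generalizing i with
  | zero => exact @Subsingleton.elim _ E.level_zero _ _
  | succ n ih =>
    cases i with
    | zero => rw [vOne_zero, mul_one, dlogNegOne_eq_dvTail]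
    | succ i =>
      rw [← E.commute_of_mem (E.vOne_mem _ _) (E.dlogNegOne_mem _), vOne_succ, E.V_mul,
        F_dlogNegOne, E.commute_of_mem (E.vOne_mem _ _) (E.dlogNegOne_mem _), ih, V_dvTail]

theorem F_dvOne_succ (n i : ℕ) :
    E.F n (E.dvOne (n + 1) (i + 1)) = E.dvOne n i + E.dvTail n i := by
  rw [dvOne, vOne_succ, E.F_d_V, PreWittComplex.iota, dlogNegOne_mul_vOne]
  rfl

theorem vOne_mul_vOne_eq (n i j : ℕ) (h : i ≤ j) :
    E.vOne n i * E.vOne n j = 2 ^ i • E.vOne n j := by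
  induction n generalizing i j with
  | zero => exact @Subsingleton.elim _ E.level_zero _ _
  | succ n ih =>
    cases i with
    | zero => rw [vOne_zero, one_mul, pow_zero, one_smul]
    | succ i =>
      obtain ⟨j, rfl⟩ := Nat.exists_eq_succ_of_ne_zero (show j ≠ 0 by omega)
      rw [vOne_succ, E.V_mul, Nat.succ_eq_add_one, vOne_succ, E.F_V, two_mul, mul_add,
        ih i j (by omega), ← two_nsmul, ← mul_nsmul', ← pow_succ', map_nsmul]

/-- The tail is `δ V^j(1)`, and `V^i(1) V^j(1)` is divisible by `2` when `i, j ≥ 1`, while `2δ = 0`.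
-/
theorem vOne_mul_dvTail {n i : ℕ} (hi : 1 ≤ i) (j : ℕ) (hj : 1 ≤ j) :
    E.vOne n i * E.dvTail n j = 0 := by
  rw [← dlogNegOne_mul_vOne, ← mul_assoc, E.commute_of_mem (E.vOne_mem _ _) (E.dlogNegOne_mem _),
    mul_assoc]
  have key : ∀ k l : ℕ, 1 ≤ k → k ≤ l → E.dlogNegOne n * (E.vOne n k * E.vOne n l) = 0 := by
    intro k l hk hkl
    obtain ⟨k, rfl⟩ := Nat.exists_eq_succ_of_ne_zero (show k ≠ 0 by omega)
    rw [vOne_mul_vOne_eq E n _ _ hkl, mul_smul_comm, dlogNegOne_mul_vOne, Nat.succ_eq_add_one,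
      pow_succ, mul_nsmul', two_nsmul_dvTail, smul_zero]
  rcases le_total i j with h | h
  · exact key i j hi h
  · rw [E.commute_of_mem (E.vOne_mem _ _) (E.vOne_mem _ _)]
    exact key j i hj h

theorem vOne_mul_dvTail_zero (n i : ℕ) : E.vOne n i * E.dvTail n 0 = E.dvTail n i := by
  rw [← dlogNegOne_eq_dvTail, E.commute_of_mem (E.vOne_mem _ _) (E.dlogNegOne_mem _),
    dlogNegOne_mul_vOne]

/-- Both cases of the product formula in one: for `j ≤ i` the first term is zero. The induction uses
`V(x)y = V(xF(y))` together with `F(dV^(j+1)(1)) = dV^j(1) + tail`. -/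
theorem vOne_mul_dvOne (n : ℕ) {i j : ℕ} (hi : 1 ≤ i) (hj : 1 ≤ j) :
    E.vOne n i * E.dvOne n j = 2 ^ i • E.dvOne n j + E.dvTail n (max i j) := by
  induction n generalizing i j with
  | zero => exact @Subsingleton.elim _ E.level_zero _ _
  | succ n ih =>
    obtain ⟨i, rfl⟩ := Nat.exists_eq_succ_of_ne_zero (show i ≠ 0 by omega)
    obtain ⟨j, rfl⟩ := Nat.exists_eq_succ_of_ne_zero (show j ≠ 0 by omega)
    rw [Nat.succ_eq_add_one, Nat.succ_eq_add_one, vOne_succ, E.V_mul, F_dvOne_succ, mul_add,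
      map_add, Nat.add_max_add_right]
    have h2 : 2 ^ (i + 1) • E.dvOne (n + 1) (j + 1) = E.V n (2 ^ i • E.dvOne n j) := by
      rw [map_nsmul, V_dvOne_eq, ← mul_nsmul', ← pow_succ]
    rw [h2]
    -- At `i = 0` or `j = 0` the tail coming from `F` survives; otherwise it is killed by `V^i(1)`,
    -- and the induction hypothesis supplies the tail.
    rcases Nat.eq_zero_or_pos i with rfl | hi
    · rw [vOne_zero, one_mul, one_mul, pow_zero, one_smul, V_dvTail, Nat.zero_max]
    rcases Nat.eq_zero_or_pos j with rfl | hj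
    · rw [dvOne_zero, mul_zero, smul_zero, map_zero, vOne_mul_dvTail_zero, V_dvTail,
        Nat.max_zero]
    · rw [ih hi hj, vOne_mul_dvTail E hi j hj, map_zero, add_zero, map_add, V_dvTail]

theorem d_d_eq (n : ℕ) (x : E.X n) : E.d n (E.d n x) = E.dlogNegOne n * E.d n x := by
  rw [E.d_d, E.d_iota]
  rfl

theorem two_nsmul_dlogNegOne_mul (n k : ℕ) (hk : 1 ≤ k) (x : E.X n) :
    2 ^ k • (E.dlogNegOne n * x) = 0 := by
  obtain ⟨k, rfl⟩ := Nat.exists_eq_succ_of_ne_zero (show k ≠ 0 by omega)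
  rw [pow_succ, mul_nsmul', ← smul_mul_assoc, two_nsmul_dlogNegOne, zero_mul, smul_zero]

/-- For `k ≥ 1` the coefficients `2^(s-1)` are even, and `ddV^s(1) = δ dV^s(1)` is killed by `2`. -/
theorem d_dvTail {n k : ℕ} (hk : 1 ≤ k) : E.d n (E.dvTail n k) = 0 := by
  rw [dvTail, map_sum]
  refine Finset.sum_eq_zero fun s hs => ?_
  have := (Finset.mem_Ico.mp hs).1
  rw [map_nsmul, dvOne, d_d_eq, two_nsmul_dlogNegOne_mul E n _ (by omega)]

theorem dlogNegOne_mul_dvTail {n k : ℕ} (hk : 1 ≤ k) : E.dlogNegOne n * E.dvTail n k = 0 := by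
  rw [dvTail, Finset.mul_sum]
  refine Finset.sum_eq_zero fun s hs => ?_
  have := (Finset.mem_Ico.mp hs).1
  rw [mul_smul_comm, two_nsmul_dlogNegOne_mul E n _ (by omega)]

/-- For `j ≤ i` differentiate `V^i(1) dV^j(1) = tail`. The tail is closed, and `V^i(1) ddV^j(1) = δ
· tail = 0`, so only `dV^i(1) dV^j(1)` remains. The other order follows by graded commutativity. -/
theorem dvOne_mul_dvOne (n i j : ℕ) : E.dvOne n i * E.dvOne n j = 0 := by
  have key : ∀ i j : ℕ, j ≤ i → E.dvOne n i * E.dvOne n j = 0 := by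
    intro i j hij
    rcases Nat.eq_zero_or_pos j with rfl | hj
    · rw [dvOne_zero, mul_zero]
    have hi : 1 ≤ i := Nat.le_trans hj hij
    have h1 : E.vOne n i * E.dvOne n j = E.dvTail n i := by
      rw [vOne_mul_dvOne E n hi hj, two_pow_nsmul_dvOne_of_le E n hij, zero_add,
        max_eq_left hij]
    have h2 := E.d_mul_zero (E.dvOne n j) (E.vOne_mem n i)
    rw [h1, d_dvTail E hi, dvOne, d_d_eq, ← mul_assoc,
      E.commute_of_mem (E.vOne_mem _ _) (E.dlogNegOne_mem _), mul_assoc] at h2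
    change 0 = E.dvOne n i * E.dvOne n j + E.dlogNegOne n * (E.vOne n i * E.dvOne n j) at h2
    rw [h1, dlogNegOne_mul_dvTail E hi, add_zero] at h2
    exact h2.symm
  rcases le_total j i with h | h
  · exact key i j h
  · rw [E.mul_comm_deg (E.dvOne_mem n i) (E.dvOne_mem n j), key j i h, mul_zero]

/-- `ddV^i(1) = δ dV^i(1)`, and `δ` is a combination of the `dV^s(1)`. -/
theorem d_dvOne (n i : ℕ) : E.d n (E.dvOne n i) = 0 := by
  rw [dvOne, d_d_eq, dlogNegOne_eq_dvTail, dvTail, Finset.sum_mul]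
  refine Finset.sum_eq_zero fun s _ => ?_
  rw [smul_mul_assoc]
  change _ • (E.dvOne n s * E.dvOne n i) = 0
  rw [dvOne_mul_dvOne, smul_zero]

theorem R_vOne_eq (n i : ℕ) : E.R n (E.vOne (n + 1) i) = E.vOne n i := by
  induction n generalizing i with
  | zero => exact @Subsingleton.elim _ E.level_zero _ _
  | succ n ih =>
    cases i with
    | zero => rw [vOne_zero, vOne_zero, map_one]
    | succ i => rw [vOne_succ, E.R_V, ih, vOne_succ]

theorem R_dvOne_eq (n i : ℕ) : E.R n (E.dvOne (n + 1) i) = E.dvOne n i := by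
  rw [dvOne, E.R_d, R_vOne_eq, dvOne]

/-- Ensures that every morphism, being compatible with `λ`, preserves `V^i(1)`. -/
theorem vOne_eq_lam (n i : ℕ) :
    E.vOne n i = E.lam n (WittVector.truncate n (WittVector.verschiebung^[i] 1)) := by
  induction n generalizing i with
  | zero => exact @Subsingleton.elim _ E.level_zero _ _
  | succ n ih =>
    cases i with
    | zero => rw [vOne_zero, Function.iterate_zero_apply, map_one, map_one]
    | succ i =>
      rw [vOne_succ, ih, E.V_lam, Function.iterate_succ_apply']
      rw [TwoWitt.ver_truncate]

end WittComplex

/-! ### Maps between the groups `ℤ/2^(j+1)` -/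

namespace ZModTwoPow

/-- Reduction modulo `2`. -/
def red (j : ℕ) : ZMod (2 ^ (j + 1)) →+* ZMod 2 :=
  ZMod.castHom (dvd_pow_self 2 (Nat.succ_ne_zero j)) _

/-- Reduction `ℤ/2^(j+2) → ℤ/2^(j+1)`. -/
def low (j : ℕ) : ZMod (2 ^ (j + 1 + 1)) →+* ZMod (2 ^ (j + 1)) :=
  ZMod.castHom (pow_dvd_pow 2 (Nat.le_succ _)) _

/-- The injection `ℤ/2 → ℤ/2^(j+1)`. -/
def inc (j : ℕ) : ZMod 2 →+ ZMod (2 ^ (j + 1)) :=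
  ZMod.lift 2 ⟨zmultiplesHom _ (2 ^ j), by
    have : ((2 ^ (j + 1) : ℕ) : ZMod (2 ^ (j + 1))) = 0 := ZMod.natCast_self _
    push_cast at this
    simp [← this, pow_succ']⟩

/-- The injection `ℤ/2^(j+1) → ℤ/2^(j+2)`. -/
def dbl (j : ℕ) : ZMod (2 ^ (j + 1)) →+ ZMod (2 ^ (j + 1 + 1)) :=
  ZMod.lift _ ⟨zmultiplesHom _ 2, by
    have : ((2 ^ (j + 1 + 1) : ℕ) : ZMod (2 ^ (j + 1 + 1))) = 0 := ZMod.natCast_self _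
    push_cast at this
    simp [← this, pow_succ]⟩

@[simp]
theorem inc_intCast (j : ℕ) (c : ℤ) : inc j (c : ZMod 2) = 2 ^ j * c := by
  simp [inc, mul_comm]

@[simp]
theorem dbl_intCast (j : ℕ) (c : ℤ) : dbl j (c : ZMod (2 ^ (j + 1))) = 2 * c := by
  simp [dbl, mul_comm]

theorem two_pow_eq_zero (j : ℕ) : (2 : ZMod (2 ^ j)) ^ j = 0 := by
  have : ((2 ^ j : ℕ) : ZMod (2 ^ j)) = 0 := ZMod.natCast_self _
  exact_mod_cast this

/-- Projection formula; with `dbl_low_mul` it is what turns into `V(x)y = V(xF(y))` in the model. -/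
theorem inc_red_mul (j : ℕ) (a : ZMod (2 ^ (j + 1))) (t : ZMod 2) :
    inc j (red j a * t) = a * inc j t := by
  obtain ⟨a, rfl⟩ := ZMod.intCast_surjective a
  obtain ⟨t, rfl⟩ := ZMod.intCast_surjective t
  rw [map_intCast, ← Int.cast_mul, inc_intCast, inc_intCast]
  push_cast
  ring

theorem red_inc_succ (j : ℕ) (t : ZMod 2) : red (j + 1) (inc (j + 1) t) = 0 := by
  obtain ⟨t, rfl⟩ := ZMod.intCast_surjective t
  have : (2 : ZMod 2) = 0 := rfl
  rw [inc_intCast, map_mul, map_pow, map_ofNat, this, zero_pow (Nat.succ_ne_zero j), zero_mul]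

theorem low_inc (j : ℕ) (t : ZMod 2) : low j (inc (j + 1) t) = 0 := by
  obtain ⟨t, rfl⟩ := ZMod.intCast_surjective t
  rw [inc_intCast, map_mul, map_pow, map_ofNat, two_pow_eq_zero, zero_mul]

theorem dbl_inc (j : ℕ) (t : ZMod 2) : dbl j (inc j t) = inc (j + 1) t := by
  obtain ⟨t, rfl⟩ := ZMod.intCast_surjective t
  have := dbl_intCast j (2 ^ j * t)
  push_cast at this
  rw [inc_intCast, this, inc_intCast]
  ring

theorem dbl_low_mul (j : ℕ) (a : ZMod (2 ^ (j + 1 + 1))) (b : ZMod (2 ^ (j + 1))) :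
    dbl j (low j a * b) = a * dbl j b := by
  obtain ⟨a, rfl⟩ := ZMod.intCast_surjective a
  obtain ⟨b, rfl⟩ := ZMod.intCast_surjective b
  rw [map_intCast, ← Int.cast_mul, dbl_intCast, dbl_intCast]
  push_cast
  ring

theorem dbl_low (j : ℕ) (a : ZMod (2 ^ (j + 1 + 1))) : dbl j (low j a) = 2 * a := by
  obtain ⟨a, rfl⟩ := ZMod.intCast_surjective a
  rw [map_intCast, dbl_intCast]

theorem low_dbl (j : ℕ) (a : ZMod (2 ^ (j + 1))) : low j (dbl j a) = 2 * a := by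
  obtain ⟨a, rfl⟩ := ZMod.intCast_surjective a
  rw [dbl_intCast, map_mul, map_ofNat, map_intCast]

theorem red_low (j : ℕ) (a : ZMod (2 ^ (j + 1 + 1))) : red j (low j a) = red (j + 1) a := by
  obtain ⟨a, rfl⟩ := ZMod.intCast_surjective a
  simp

theorem red_dbl (j : ℕ) (a : ZMod (2 ^ (j + 1))) : red (j + 1) (dbl j a) = 0 := by
  obtain ⟨a, rfl⟩ := ZMod.intCast_surjective a
  have : (2 : ZMod 2) = 0 := rfl
  rw [dbl_intCast, map_mul, map_ofNat, this, zero_mul]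

theorem red_inc_zero (t : ZMod 2) : red 0 (inc 0 t) = t := by
  obtain ⟨a, rfl⟩ := ZMod.intCast_surjective t
  rw [inc_intCast, pow_zero, one_mul, map_intCast]

end ZModTwoPow

open ZModTwoPow

/-! ### The limit of the components of degree one -/

/-- The limit over `n` of the groups `W_nΩ^1_A`: the factor with index `j` is generated by
`dV^{j+1}(1)`. -/
def DrwOne (_A : Type) : Type := ∀ j : ℕ, ZMod (2 ^ (j + 1))

namespace DrwOne

variable {A : Type}

instance : AddCommGroup (DrwOne A) := inferInstanceAs (AddCommGroup (∀ j : ℕ, ZMod (2 ^ (j + 1))))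

@[ext]
theorem ext {m m' : DrwOne A} (h : ∀ j, m j = m' j) : m = m' := funext h

@[simp] theorem zero_apply (j : ℕ) : (0 : DrwOne A) j = 0 := rfl

@[simp] theorem add_apply (m m' : DrwOne A) (j : ℕ) : (m + m') j = m j + m' j := rfl

/-- The sum modulo `2` of the first `j` components. -/
def tau (j : ℕ) : DrwOne A →+ ZMod 2 where
  toFun m := ∑ k ∈ Finset.range j, red k (m k)
  map_zero' := by simp
  map_add' m m' := by simp [Finset.sum_add_distrib]

theorem tau_apply (j : ℕ) (m : DrwOne A) : tau j m = ∑ k ∈ Finset.range j, red k (m k) := rfl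

@[simp] theorem tau_zero (m : DrwOne A) : tau 0 m = 0 := rfl

theorem tau_succ (j : ℕ) (m : DrwOne A) : tau (j + 1) m = tau j m + red j (m j) :=
  Finset.sum_range_succ _ _

theorem tau_congr {j : ℕ} {m m' : DrwOne A} (h : ∀ k < j, red k (m k) = red k (m' k)) :
    tau j m = tau j m' :=
  Finset.sum_congr rfl fun k hk => h k (Finset.mem_range.mp hk)

theorem tau_eq_zero {j : ℕ} {m : DrwOne A} (h : ∀ k < j, m k = 0) : tau j m = 0 :=
  (tau_congr (m' := 0) fun k hk => by rw [h k hk, zero_apply]).trans (map_zero _)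

theorem red_inc_tau_mul (j : ℕ) (m : DrwOne A) (t : ZMod 2) :
    red j (inc j (tau j m * t)) = 0 := by
  cases j with
  | zero => simp
  | succ j => exact red_inc_succ j _

/-- The Frobenius in degree one. -/
def frob : DrwOne A →+ DrwOne A where
  -- Each `m_k` contributes to `F(m)` a tail starting at index `k`, so the coefficient of `2^j
  -- dV^(j+1)(1)` is the parity of `m_0 + … + m_j`, which is `tau (j + 1)`.
  toFun m j := low j (m (j + 1)) + inc j (tau (j + 1) m)
  map_zero' := by ext j; simp
  map_add' m m' := by
    ext j
    change _ = (low j (m (j + 1)) + inc j (tau (j + 1) m))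
      + (low j (m' (j + 1)) + inc j (tau (j + 1) m'))
    rw [add_apply, map_add, map_add, map_add, add_add_add_comm]

theorem frob_apply (m : DrwOne A) (j : ℕ) :
    frob m j = low j (m (j + 1)) + inc j (tau (j + 1) m) := rfl

/-- The Verschiebung in degree one. -/
def ver : DrwOne A →+ DrwOne A where
  toFun m
    | 0 => 0
    | j + 1 => dbl j (m j)
  map_zero' := by
    ext j
    cases j <;> simp
  map_add' m m' := by
    ext j
    cases j with
    | zero => exact (add_zero (0 : ZMod (2 ^ (0 + 1)))).symm
    | succ j => exact map_add (dbl j) _ _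

theorem ver_apply_zero (m : DrwOne A) : ver m 0 = 0 := rfl

theorem ver_apply_succ (m : DrwOne A) (j : ℕ) : ver m (j + 1) = dbl j (m j) := rfl

theorem tau_ver (m : DrwOne A) (j : ℕ) : tau j (ver m) = 0 := by
  rw [tau_apply]
  refine Finset.sum_eq_zero fun k _ => ?_
  cases k with
  | zero => rw [ver_apply_zero, map_zero]
  | succ k => rw [ver_apply_succ, red_dbl]

/-- Modulo `2`, `F` shifts the components; its correction is odd at most at index `0`, where it
restores the lost `m_0`. -/
theorem tau_frob (m : DrwOne A) (j : ℕ) : tau (j + 1) (frob m) = tau (j + 1 + 1) m := by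
  induction j with
  | zero =>
    rw [tau_succ, tau_succ, tau_succ, tau_zero, tau_zero, frob_apply, map_add,
      red_low, red_inc_zero, tau_succ, tau_zero]
    simp only [zero_add]
    rw [add_comm]
  | succ j ih =>
    rw [tau_succ, ih, tau_succ (j + 1 + 1) m, frob_apply, map_add, red_low, red_inc_succ, add_zero]

theorem frob_ver (m : DrwOne A) : frob (ver m) = m + m := by
  ext j
  rw [frob_apply, ver_apply_succ, low_dbl, tau_ver, map_zero, add_zero, two_mul, add_apply]

/-- The limit of the elements `dlog [-1]`. -/
def dlogNegOne : DrwOne A := fun j => inc j 1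

theorem dlogNegOne_apply (j : ℕ) : (dlogNegOne : DrwOne A) j = inc j 1 := rfl

theorem tau_dlogNegOne (j : ℕ) : tau (j + 1) (dlogNegOne : DrwOne A) = 1 := by
  induction j with
  | zero => rw [tau_succ, tau_zero, zero_add, dlogNegOne_apply, red_inc_zero]
  | succ j ih => rw [tau_succ, ih, dlogNegOne_apply, red_inc_succ, add_zero]

end DrwOne

/-! ### Uniqueness and compatibility of the reductions modulo `2^k` -/

namespace TwoIntegral

variable {A : Type} [CommRing A] [TwoIntegral A]

/-- The equation `q a = p` with `q` odd determines the image of `a`, as `q` is a unit modulo `2^k`.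
-/
theorem ringHom_ext {k : ℕ} (f g : A →+* ZMod (2 ^ k)) : f = g := by
  ext a
  obtain ⟨p, q, hq, -, h⟩ := exists_frac a
  have hf := congrArg f h
  have hg := congrArg g h
  rw [map_mul, map_intCast, map_intCast] at hf hg
  exact (isUnit_intCast_zmod hq k).mul_left_cancel (hf.trans hg.symm)

theorem proj_two_pow_mul (k : ℕ) (a : A) : proj k (2 ^ k * a) = 0 := by
  rw [map_mul, map_pow, map_ofNat, two_pow_eq_zero, zero_mul]

theorem low_proj (j : ℕ) (a : A) : low j (proj (j + 1 + 1) a) = proj (j + 1) a :=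
  RingHom.congr_fun (ringHom_ext ((low j).comp (proj (j + 1 + 1))) (proj (j + 1))) a

/-- Reduction modulo `2`. -/
def parity : A →+* ZMod 2 := (red 0).comp (proj (0 + 1))

theorem red_proj (j : ℕ) (a : A) : red j (proj (j + 1) a) = parity a := by
  induction j with
  | zero => rfl
  | succ j ih => rw [← red_low, low_proj, ih]

theorem parity_two_mul (a : A) : parity (2 * a) = 0 := by
  rw [map_mul, map_ofNat]
  exact zero_mul _

end TwoIntegral

/-! ### Ghost components modulo powers of `2` and the differential -/

namespace WittVector

open TwoIntegral

variable {A : Type} [CommRing A] [TwoIntegral A]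

/-- The ghost component `w_{j+1}` modulo `2 ^ (j + 1)`. -/
noncomputable def ghostMod (j : ℕ) : WittVector 2 A →+* ZMod (2 ^ (j + 1)) :=
  (proj (j + 1)).comp (ghostComponent (j + 1))

/-- The ghost components modulo `2`. -/
noncomputable def ghostParity : WittVector 2 A →+* ZMod 2 := parity.comp (ghostComponent 0)

theorem parity_ghostComponent (j : ℕ) (x : WittVector 2 A) :
    parity (ghostComponent j x) = ghostParity x := by
  induction j with
  | zero => rfl
  | succ j ih =>
    rw [← ih, ← sub_eq_zero, ← map_sub, ← two_pow_mul_ghostDiff, pow_succ', mul_assoc,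
      parity_two_mul]

theorem red_ghostMod (j : ℕ) (x : WittVector 2 A) : red j (ghostMod j x) = ghostParity x :=
  (red_proj j _).trans (parity_ghostComponent _ x)

theorem proj_ghostComponent (j : ℕ) (x : WittVector 2 A) :
    proj (j + 1) (ghostComponent j x) = ghostMod j x := by
  symm
  rw [← sub_eq_zero, ghostMod, RingHom.comp_apply, ← map_sub, ← two_pow_mul_ghostDiff,
    proj_two_pow_mul]

theorem inc_ghostParity_mul (j : ℕ) (x : WittVector 2 A) (t : ZMod 2) :
    inc j (ghostParity x * t) = ghostMod j x * inc j t := by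
  rw [← red_ghostMod j, inc_red_mul]

/-- The differential `d : W(A) → lim W_nΩ^1_A`. -/
noncomputable def drwDiff : WittVector 2 A →+ DrwOne A where
  -- `ghostDiff j x` is the coefficient of `V^(j+1)(1)` in `x`, and `dV^(j+1)(1)` has order
  -- `2^(j+1)`.
  toFun x j := proj (j + 1) (ghostDiff j x)
  map_zero' := by ext j; simp
  map_add' x y := by
    ext j
    exact (congrArg _ (map_add _ _ _)).trans (map_add _ _ _)

theorem drwDiff_apply (x : WittVector 2 A) (j : ℕ) :
    drwDiff x j = proj (j + 1) (ghostDiff j x) := rfl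

theorem ghostMod_eq_zero {n : ℕ} {x : WittVector 2 A} (h : truncate n x = 0) {j : ℕ}
    (hj : j + 1 < n) : ghostMod j x = 0 := by
  rw [ghostMod, RingHom.comp_apply, truncate_eq_zero_iff_ghostComponent.mp h _ hj, map_zero]

theorem drwDiff_eq_zero {n : ℕ} {x : WittVector 2 A} (h : truncate n x = 0) {j : ℕ}
    (hj : j + 1 < n) : drwDiff x j = 0 := by
  rw [drwDiff_apply, show ghostDiff j x = 0 from truncate_eq_zero_iff_ghostCoord.mp h _ hj,
    map_zero]

/-- The product rule for difference quotients has `w_j` in one term and `w_{j+1}` in the other;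
modulo `2^(j+1)` they agree. -/
theorem drwDiff_mul_apply (x y : WittVector 2 A) (j : ℕ) :
    drwDiff (x * y) j = ghostMod j x * drwDiff y j + ghostMod j y * drwDiff x j := by
  have h : ghostDiff j (x * y) = ghostComponent (j + 1) x * ghostDiff j y
      + ghostComponent j y * ghostDiff j x := by
    apply ghostDiff_eq
    rw [map_mul, map_mul]
    linear_combination -ghostComponent (j + 1) x * two_pow_mul_ghostDiff j y
      - ghostComponent j y * two_pow_mul_ghostDiff j x
  rw [drwDiff_apply, h, map_add, map_mul, map_mul, proj_ghostComponent]
  rfl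

@[simp]
theorem drwDiff_one : drwDiff (1 : WittVector 2 A) = 0 := by
  ext j
  rw [drwDiff_apply, ghostDiff_eq (a := 0) (by simp)]
  simp

end WittVector

/-! ### The twisted action of `W(A)` and the Witt complex identities in degree one -/

namespace DrwOne

open TwoIntegral WittVector

variable {A : Type} [CommRing A] [TwoIntegral A]

/-- For `x = V^i(1)` and `m = dV^j(1)` with `i, j ≥ 1`, both parities in the second term are `1`
exactly from index `max i j` on, which yields the tail of the product formula. -/
noncomputable instance : SMul (WittVector 2 A) (DrwOne A) where
  smul x m j := ghostMod j x * m j + inc j (tau j (drwDiff x) * tau j m)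

theorem smul_apply (x : WittVector 2 A) (m : DrwOne A) (j : ℕ) :
    (x • m) j = ghostMod j x * m j + inc j (tau j (drwDiff x) * tau j m) := rfl

/-- The correction is even: a multiple of `2^j` for `j ≥ 1`, and zero for `j = 0` since `tau 0` is
an empty sum. -/
theorem tau_smul (x : WittVector 2 A) (m : DrwOne A) (j : ℕ) :
    tau j (x • m) = ghostParity x * tau j m := by
  rw [tau_apply, tau_apply, Finset.mul_sum]
  refine Finset.sum_congr rfl fun k _ => ?_
  rw [smul_apply, map_add, map_mul, red_ghostMod, red_inc_tau_mul, add_zero]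

theorem inc_add_self (j : ℕ) (t : ZMod 2) : inc j t + inc j t = 0 := by
  rw [← map_add, CharTwo.add_self_eq_zero, map_zero]

/-- The correction is symmetric in `dx` and `dy` and is killed by `2`, so its two copies cancel. -/
theorem drwDiff_mul (x y : WittVector 2 A) :
    drwDiff (x * y) = x • drwDiff y + y • drwDiff x := by
  ext j
  rw [add_apply, smul_apply, smul_apply, drwDiff_mul_apply, mul_comm (tau j (drwDiff y)),
    add_add_add_comm, inc_add_self, add_zero]

noncomputable instance : Module (WittVector 2 A) (DrwOne A) where
  one_smul m := by ext j; simp [smul_apply]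
  mul_smul x y m := by
    ext j
    rw [smul_apply, smul_apply, drwDiff_mul, map_add, tau_smul, tau_smul, tau_smul, smul_apply,
      add_mul, map_add, map_mul, mul_assoc (ghostParity x), inc_ghostParity_mul, mul_add,
      mul_assoc, add_assoc]
    congr 3
    ring_nf
  smul_zero x := by ext j; simp [smul_apply]
  smul_add x m m' := by
    ext j
    simp only [smul_apply, add_apply, map_add, mul_add]
    abel
  add_smul x y m := by
    ext j
    simp only [smul_apply, add_apply, map_add, add_mul]
    abel
  zero_smul m := by ext j; simp [smul_apply]

/-- Used for the ring structure on the square-zero extension. -/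
noncomputable instance : Module (WittVector 2 A)ᵐᵒᵖ (DrwOne A) :=
  Module.compHom _ ((RingHom.id (WittVector 2 A)).fromOpposite fun x y => mul_comm x y)

instance : IsCentralScalar (WittVector 2 A) (DrwOne A) where
  op_smul_eq_smul _ _ := rfl

theorem drwDiff_frobenius_apply (x : WittVector 2 A) (j : ℕ) :
    drwDiff (frobenius x) j = 2 * low j (drwDiff x (j + 1)) := by
  have h : ghostDiff j (frobenius x) = 2 * ghostDiff (j + 1) x := by
    apply ghostDiff_eq
    rw [ghostComponent_frobenius, ghostComponent_frobenius, ← two_pow_mul_ghostDiff]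
    ring
  rw [drwDiff_apply, h, map_mul, map_ofNat, drwDiff_apply, low_proj]

theorem tau_drwDiff_frobenius (x : WittVector 2 A) (j : ℕ) :
    tau j (drwDiff (frobenius x)) = 0 := by
  rw [tau_apply]
  refine Finset.sum_eq_zero fun k _ => ?_
  rw [drwDiff_frobenius_apply, map_mul, map_ofNat]
  exact zero_mul _

theorem ghostMod_frobenius (x : WittVector 2 A) (j : ℕ) :
    ghostMod j (frobenius x) = low j (ghostMod (j + 1) x) := by
  rw [ghostMod, ghostMod, RingHom.comp_apply, RingHom.comp_apply, low_proj,
    ghostComponent_frobenius]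

/-- The correction in `x • m` dies under `low`, and the one for `F(x)` dies because `dF(x)` is even.
What remains is the parity rule for `tau`. -/
theorem frob_smul (x : WittVector 2 A) (m : DrwOne A) : frob (x • m) = frobenius x • frob m := by
  ext j
  rw [smul_apply, tau_drwDiff_frobenius, zero_mul, map_zero, add_zero, frob_apply, frob_apply,
    tau_smul, inc_ghostParity_mul, smul_apply, map_add, low_inc, add_zero, map_mul,
    ghostMod_frobenius, mul_add, ← inc_red_mul j (low j _), red_low, red_ghostMod,
    inc_ghostParity_mul]

theorem drwDiff_verschiebung_zero (x : WittVector 2 A) :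
    drwDiff (verschiebung x) 0 = ghostMod 0 x := by
  rw [← proj_ghostComponent, drwDiff_apply]
  congr 1
  apply ghostDiff_eq
  rw [ghostComponent_verschiebung, ghostComponent_zero_verschiebung]
  push_cast
  ring

theorem ghostDiff_verschiebung_succ (x : WittVector 2 A) (j : ℕ) :
    ghostDiff (j + 1) (verschiebung x) = ghostDiff j x := by
  apply ghostDiff_eq
  rw [ghostComponent_verschiebung, ghostComponent_verschiebung]
  push_cast
  linear_combination -2 * two_pow_mul_ghostDiff j x

theorem low_drwDiff_verschiebung (x : WittVector 2 A) (j : ℕ) :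
    low j (drwDiff (verschiebung x) (j + 1)) = drwDiff x j := by
  rw [drwDiff_apply, drwDiff_apply, low_proj, ghostDiff_verschiebung_succ]

theorem tau_drwDiff_verschiebung (x : WittVector 2 A) (j : ℕ) :
    tau (j + 1) (drwDiff (verschiebung x)) = ghostParity x + tau j (drwDiff x) := by
  induction j with
  | zero =>
    rw [tau_succ, tau_zero, tau_zero, zero_add, add_zero, drwDiff_verschiebung_zero, red_ghostMod]
  | succ j ih =>
    rw [tau_succ, ih, tau_succ j, ← red_low, low_drwDiff_verschiebung, add_assoc]

theorem ghostMod_verschiebung_succ (x : WittVector 2 A) (j : ℕ) :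
    ghostMod (j + 1) (verschiebung x) = dbl j (ghostMod j x) := by
  rw [ghostMod, ghostMod, RingHom.comp_apply, RingHom.comp_apply, ghostComponent_verschiebung,
    map_mul, map_natCast, ← low_proj j, dbl_low, Nat.cast_ofNat]

theorem verschiebung_smul (x : WittVector 2 A) (m : DrwOne A) :
    verschiebung x • m = ver (x • frob m) := by
  ext j
  cases j with
  | zero =>
    rw [smul_apply, tau_zero, zero_mul, map_zero, add_zero, ver_apply_zero,
      ← proj_ghostComponent, ghostComponent_zero_verschiebung, map_zero, zero_mul]
  | succ j =>
    -- The formula for `tau j (frob m)` needs `j ≥ 1`; at `j = 0` the other factor is zero.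
    have h : tau j (drwDiff x) * tau j (frob m) = tau j (drwDiff x) * tau (j + 1) m := by
      cases j with
      | zero => simp
      | succ j => rw [tau_frob]
    rw [ver_apply_succ, smul_apply, smul_apply, map_add, dbl_inc, h, frob_apply, mul_add, map_add,
      ← inc_ghostParity_mul, dbl_inc, mul_comm (ghostMod j x), dbl_low_mul,
      ghostMod_verschiebung_succ, tau_drwDiff_verschiebung, add_mul, map_add]
    ring

theorem frob_drwDiff_verschiebung (x : WittVector 2 A) :
    frob (drwDiff (verschiebung x)) = drwDiff x + x • dlogNegOne := by
  ext j
  have h : tau j (drwDiff x) * tau j (dlogNegOne : DrwOne A) = tau j (drwDiff x) := by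
    cases j with
    | zero => rw [tau_zero, zero_mul]
    | succ j => rw [tau_dlogNegOne, mul_one]
  rw [frob_apply, low_drwDiff_verschiebung, tau_drwDiff_verschiebung, add_apply, smul_apply, h,
    dlogNegOne_apply, map_add, ← inc_ghostParity_mul, mul_one]

theorem teichmuller_neg_one_smul_drwDiff :
    teichmuller 2 (-1 : A) • drwDiff (teichmuller 2 (-1 : A)) = dlogNegOne := by
  rw [teichmuller_neg_one, map_add, map_neg, drwDiff_one, neg_zero, zero_add, add_smul, neg_smul,
    one_smul, verschiebung_smul, one_smul, frob_drwDiff_verschiebung, drwDiff_one, zero_add,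
    one_smul]
  ext j
  cases j with
  | zero =>
    rw [add_apply, ver_apply_zero, add_zero]
    -- The component lies in `ℤ/2`, where `-1 = 1`.
    change -(drwDiff (verschiebung (1 : WittVector 2 A)) 0) = _
    rw [drwDiff_verschiebung_zero, map_one]
    rfl
  | succ j =>
    rw [add_apply, ver_apply_succ, dlogNegOne_apply, dbl_inc]
    change -(drwDiff (verschiebung (1 : WittVector 2 A)) (j + 1)) + _ = _
    rw [drwDiff_apply, ghostDiff_verschiebung_succ, ghostDiff_eq (a := 0) (by simp), map_zero,
      neg_zero, zero_add]
    rfl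

theorem frob_drwDiff_teichmuller (a : A) :
    frob (drwDiff (teichmuller 2 a)) = teichmuller 2 a • drwDiff (teichmuller 2 a) := by
  ext j
  have hsq : ∀ t : ZMod 2, t * t = t := by decide
  have hinc : inc j (red j (drwDiff (teichmuller 2 a) j))
      = proj (j + 1) (2 ^ j * ghostDiff j (teichmuller 2 a)) := by
    rw [← mul_one (red j _), inc_red_mul, ← Int.cast_one, inc_intCast, drwDiff_apply, map_mul,
      map_pow, map_ofNat, Int.cast_one, mul_one, mul_comm]
  -- Since `t * t = t` modulo `2`, the parity sums on the two sides differ only in the last term,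
  -- the parity of `ghostDiff j [a]`.
  suffices key : low j (drwDiff (teichmuller 2 a) (j + 1))
      + inc j (red j (drwDiff (teichmuller 2 a) j))
        = ghostMod j (teichmuller 2 a) * drwDiff (teichmuller 2 a) j by
    rw [frob_apply, smul_apply, hsq, tau_succ, map_add]
    linear_combination key
  rw [hinc, drwDiff_apply, low_proj, drwDiff_apply, ghostMod, RingHom.comp_apply, ← map_add,
    ← map_mul]
  have h0 := two_pow_mul_ghostDiff j (teichmuller 2 a)
  obtain ⟨c, hc⟩ := two_dvd_sq_sub (ghostDiff j (teichmuller 2 a))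
  set g := ghostDiff j (teichmuller 2 a)
  have hsucc : ∀ k, a ^ 2 ^ (k + 1) = (a ^ 2 ^ k) ^ 2 := fun k => by rw [pow_succ 2 k, pow_mul]
  rw [ghostComponent_teichmuller, ghostComponent_teichmuller, hsucc] at h0
  -- Put `b = a^(2^j)`, so that `b^2 - b = 2^(j+1) g`. Then `b^4 - b^2 = (b^2 - b)(b^2 + b)` and
  -- `(b^2 + b)/2 = b^2 - 2^j g`. The claim reduces to `2^j (g - g^2) ≡ 0` modulo `2^(j+1)`, which
  -- holds as `g^2 - g` is even.
  have h1 : ghostDiff (j + 1) (teichmuller 2 a) = (a ^ 2 ^ j) ^ 2 * g - 2 ^ j * g ^ 2 := by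
    apply ghostDiff_eq
    rw [ghostComponent_teichmuller, ghostComponent_teichmuller, hsucc, hsucc]
    linear_combination (2 ^ (j + 1) * g - (a ^ 2 ^ j) ^ 2 - a ^ 2 ^ j) * h0
  rw [h1, ghostComponent_teichmuller, hsucc, ← sub_eq_zero, ← map_sub,
    ← proj_two_pow_mul (j + 1) (-c)]
  congr 1
  linear_combination -2 ^ j * hc

theorem ver_smul (m : DrwOne A) (y : WittVector 2 A) :
    y • ver m = ver (frobenius y • m) := by
  ext j
  cases j with
  | zero => simp [smul_apply, ver_apply_zero]
  | succ j =>
    rw [smul_apply, tau_ver, mul_zero, map_zero, add_zero, ver_apply_succ, ver_apply_succ,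
      smul_apply, tau_drwDiff_frobenius, zero_mul, map_zero, add_zero, ghostMod_frobenius,
      dbl_low_mul]

end DrwOne

/-! ### The explicit Witt complex -/

open WittVector

/-- The limit over `n` of the explicit rings `W_nΩ^*_A`. -/
def Drw (A : Type) [CommRing A] [TwoIntegral A] : Type :=
  TrivSqZeroExt (WittVector 2 A) (DrwOne A)

namespace Drw

variable {A : Type} [CommRing A] [TwoIntegral A]

noncomputable instance : CommRing (Drw A) :=
  inferInstanceAs (CommRing (TrivSqZeroExt (WittVector 2 A) (DrwOne A)))

/-- The inclusion of degree zero. -/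
noncomputable def inl : WittVector 2 A →+* Drw A := TrivSqZeroExt.inlHom _ _

/-- The inclusion of degree one. -/
noncomputable def inr : DrwOne A →+ Drw A :=
  (TrivSqZeroExt.inrHom (WittVector 2 A) (DrwOne A)).toAddMonoidHom

/-- The projection to degree zero. -/
noncomputable def fst : Drw A →+* WittVector 2 A :=
  (TrivSqZeroExt.fstHom ℤ (WittVector 2 A) (DrwOne A)).toRingHom

/-- The projection to degree one. -/
noncomputable def snd : Drw A →+ DrwOne A :=
  (TrivSqZeroExt.sndHom (WittVector 2 A) (DrwOne A)).toAddMonoidHom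

@[simp] theorem fst_inl (x : WittVector 2 A) : fst (inl x) = x := rfl

@[simp] theorem fst_inr (m : DrwOne A) : fst (inr m) = 0 := rfl

@[simp] theorem snd_inl (x : WittVector 2 A) : snd (inl x) = 0 := rfl

@[simp] theorem snd_inr (m : DrwOne A) : snd (inr m) = m := rfl

@[simp] theorem snd_one : snd (1 : Drw A) = 0 := rfl

@[simp]
theorem snd_mul (z w : Drw A) : snd (z * w) = fst z • snd w + fst w • snd z :=
  TrivSqZeroExt.snd_mul z w

@[ext]
theorem ext {z w : Drw A} (h1 : fst z = fst w) (h2 : snd z = snd w) : z = w :=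
  TrivSqZeroExt.ext h1 h2

theorem inl_fst_add_inr_snd (z : Drw A) : inl (fst z) + inr (snd z) = z := by
  ext1 <;> simp

theorem inl_mul_inr (x : WittVector 2 A) (m : DrwOne A) : inl x * inr m = inr (x • m) := by
  ext1 <;> simp

theorem inr_mul_inr (m m' : DrwOne A) : inr m * inr m' = 0 := by
  ext1 <;> simp

/-- The Frobenius. -/
noncomputable def frob : Drw A →+* Drw A where
  toFun z := inl (frobenius (fst z)) + inr (DrwOne.frob (snd z))
  map_one' := by ext1 <;> simp
  map_mul' z w := by ext1 <;> simp [DrwOne.frob_smul]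
  map_zero' := by ext1 <;> simp
  map_add' z w := by ext1 <;> simp

@[simp] theorem fst_frob (z : Drw A) : fst (frob z) = frobenius (fst z) := by simp [frob]

@[simp] theorem snd_frob (z : Drw A) : snd (frob z) = DrwOne.frob (snd z) := by simp [frob]

/-- The Verschiebung. -/
noncomputable def ver : Drw A →+ Drw A where
  toFun z := inl (verschiebung (fst z)) + inr (DrwOne.ver (snd z))
  map_zero' := by ext1 <;> simp
  map_add' z w := by ext1 <;> simp

@[simp] theorem fst_ver (z : Drw A) : fst (ver z) = verschiebung (fst z) := by simp [ver]

@[simp] theorem snd_ver (z : Drw A) : snd (ver z) = DrwOne.ver (snd z) := by simp [ver]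

/-- The differential. -/
noncomputable def diff : Drw A →+ Drw A :=
  inr.comp (drwDiff.comp (fst : Drw A →+* WittVector 2 A).toAddMonoidHom)

@[simp] theorem fst_diff (z : Drw A) : fst (diff z) = 0 := rfl

@[simp] theorem snd_diff (z : Drw A) : snd (diff z) = drwDiff (fst z) := rfl

/-- The kernel of the projection to level `n`. -/
noncomputable def fil (n : ℕ) : Ideal (Drw A) where
  carrier := {z | truncate n (fst z) = 0 ∧ ∀ j, j + 1 < n → snd z j = 0}
  zero_mem' := ⟨by simp, fun j _ => rfl⟩
  add_mem' {z w} hz hw := ⟨by rw [map_add, map_add, hz.1, hw.1, add_zero],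
    fun j hj => by rw [map_add, DrwOne.add_apply, hz.2 j hj, hw.2 j hj, add_zero]⟩
  smul_mem' c z hz := by
    refine ⟨by rw [smul_eq_mul, map_mul, map_mul, hz.1, mul_zero], fun j hj => ?_⟩
    rw [smul_eq_mul, snd_mul, DrwOne.add_apply, DrwOne.smul_apply,
      DrwOne.smul_apply, hz.2 j hj, ghostMod_eq_zero hz.1 hj,
      DrwOne.tau_eq_zero fun k hk => hz.2 k (by omega),
      DrwOne.tau_eq_zero fun k hk => drwDiff_eq_zero hz.1 (by omega)]
    simp

theorem mem_fil {n : ℕ} {z : Drw A} :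
    z ∈ fil n ↔ truncate n (fst z) = 0 ∧ ∀ j, j + 1 < n → snd z j = 0 := Iff.rfl

theorem inl_mem_fil {n : ℕ} {x : WittVector 2 A} :
    (inl x : Drw A) ∈ fil n ↔ truncate n x = 0 :=
  ⟨fun h => h.1, fun h => ⟨h, fun _ _ => rfl⟩⟩

theorem inr_mem_fil {n : ℕ} {m : DrwOne A} :
    (inr m : Drw A) ∈ fil n ↔ ∀ j, j + 1 < n → m j = 0 :=
  ⟨fun h => h.2, fun h => ⟨map_zero _, h⟩⟩

theorem fil_succ_le (n : ℕ) : (fil (n + 1) : Ideal (Drw A)) ≤ fil n := by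
  rintro z ⟨h1, h2⟩
  refine ⟨?_, fun j hj => h2 j (by omega)⟩
  rw [← TwoWitt.res_truncate, h1, map_zero]

theorem frob_mem_fil {n : ℕ} {z : Drw A} (hz : z ∈ fil (n + 1)) : frob z ∈ fil n := by
  obtain ⟨h1, h2⟩ := hz
  refine ⟨?_, fun j hj => ?_⟩
  · rw [fst_frob, ← TwoWitt.frob_truncate, h1,
      ← map_zero (truncate (n + 1) : WittVector 2 A →+* _), TwoWitt.frob_truncate, map_zero,
      map_zero]
  · rw [snd_frob, DrwOne.frob_apply, h2 _ (by omega),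
      DrwOne.tau_eq_zero fun k hk => h2 k (by omega)]
    simp

theorem ver_mem_fil {n : ℕ} {z : Drw A} (hz : z ∈ fil n) : ver z ∈ fil (n + 1) := by
  obtain ⟨h1, h2⟩ := hz
  refine ⟨?_, fun j hj => ?_⟩
  · rw [← RingHom.mem_ker, mem_ker_truncate] at h1 ⊢
    rintro (_ | i) hi
    · rw [fst_ver, verschiebung_coeff_zero]
    · rw [fst_ver, verschiebung_coeff_succ]
      exact h1 i (by omega)
  · rw [snd_ver]
    cases j with
    | zero => rfl
    | succ j => rw [DrwOne.ver_apply_succ, h2 j (by omega), map_zero]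

theorem diff_mem_fil {n : ℕ} {z : Drw A} (hz : z ∈ fil n) : diff z ∈ fil n :=
  inr_mem_fil.mpr fun _ hj => drwDiff_eq_zero hz.1 hj

variable (A) in
/-- The explicit ring `W_nΩ^*_A`. -/
abbrev Level (n : ℕ) : Type := Drw A ⧸ (fil n : Ideal (Drw A))

/-- The projection to level `n`. -/
noncomputable abbrev proj (n : ℕ) : Drw A →+* Level A n := Ideal.Quotient.mk (fil n)

theorem proj_surjective (n : ℕ) : Function.Surjective (proj n : Drw A →+* Level A n) :=
  Ideal.Quotient.mk_surjective

theorem proj_eq_zero {n : ℕ} {z : Drw A} : proj n z = 0 ↔ z ∈ fil n :=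
  Ideal.Quotient.eq_zero_iff_mem

/-- The additive map between two levels induced by an additive map. -/
noncomputable def levelMap (n k : ℕ) (f : Drw A →+ Drw A) (h : ∀ z ∈ fil n, f z ∈ fil k) :
    Level A n →+ Level A k :=
  QuotientAddGroup.map _ _ f h

/-- The embedding of degree zero. -/
noncomputable def mkInl (n : ℕ) : WittVector 2 A →+* Level A n := (proj n).comp inl

/-- The embedding of degree one. -/
noncomputable def mkInr (n : ℕ) : DrwOne A →+ Level A n :=
  (proj n).toAddMonoidHom.comp inr

theorem mkInl_apply (n : ℕ) (x : WittVector 2 A) : mkInl n x = proj n (inl x) := rfl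

theorem mkInr_apply (n : ℕ) (m : DrwOne A) : mkInr n m = proj n (inr m) := rfl

theorem mkInl_eq_zero {n : ℕ} {x : WittVector 2 A} : mkInl n x = 0 ↔ truncate n x = 0 :=
  proj_eq_zero.trans inl_mem_fil

theorem mkInr_eq_zero {n : ℕ} {m : DrwOne A} : mkInr n m = 0 ↔ ∀ j, j + 1 < n → m j = 0 :=
  proj_eq_zero.trans inr_mem_fil

theorem proj_eq_add (n : ℕ) (z : Drw A) : proj n z = mkInl n (fst z) + mkInr n (snd z) := by
  rw [mkInl_apply, mkInr_apply, ← map_add, inl_fst_add_inr_snd]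

theorem mkInl_mul_mkInr (n : ℕ) (x : WittVector 2 A) (m : DrwOne A) :
    mkInl n x * mkInr n m = mkInr n (x • m) := by
  rw [mkInl_apply, mkInr_apply, ← map_mul, inl_mul_inr, mkInr_apply]

theorem mkInr_mul_mkInr (n : ℕ) (m m' : DrwOne A) : mkInr n m * mkInr n m' = 0 := by
  rw [mkInr_apply, mkInr_apply, ← map_mul, inr_mul_inr, map_zero]

/-- The components of level `n`. -/
noncomputable def deg (n : ℕ) : ℕ → AddSubgroup (Level A n)
  | 0 => (mkInl n).toAddMonoidHom.range
  | 1 => (mkInr n).range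
  | _ + 2 => ⊥

theorem mkInl_mem (n : ℕ) (x : WittVector 2 A) : mkInl n x ∈ deg n 0 := ⟨x, rfl⟩

theorem mkInr_mem (n : ℕ) (m : DrwOne A) : mkInr n m ∈ deg n 1 := ⟨m, rfl⟩

/-- Case distinction for homogeneous elements. -/
theorem deg_induction {n : ℕ} {P : ℕ → Level A n → Prop} (h0 : ∀ x, P 0 (mkInl n x))
    (h1 : ∀ m, P 1 (mkInr n m)) (h2 : ∀ q, P (q + 2) 0) {q : ℕ} {x : Level A n}
    (hx : x ∈ deg n q) : P q x := by
  match q, hx with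
  | 0, ⟨x, hx⟩ => exact hx ▸ h0 x
  | 1, ⟨m, hm⟩ => exact hm ▸ h1 m
  | q + 2, hx => exact (AddSubgroup.mem_bot.mp hx) ▸ h2 q

instance (n : ℕ) : SetLike.GradedMonoid (deg n : ℕ → AddSubgroup (Level A n)) where
  one_mem := ⟨1, map_one (mkInl n)⟩
  mul_mem p q x y hx hy := by
    revert hy
    refine deg_induction (P := fun p x => y ∈ deg n q → x * y ∈ deg n (p + q)) ?_ ?_ ?_ hx
    · intro x hy
      refine deg_induction (P := fun q y => mkInl n x * y ∈ deg n (0 + q)) ?_ ?_ ?_ hy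
      · intro y
        rw [← map_mul]
        exact mkInl_mem n _
      · intro m
        rw [mkInl_mul_mkInr]
        exact mkInr_mem n _
      · intro q
        rw [mul_zero]
        exact zero_mem _
    · intro m hy
      refine deg_induction (P := fun q y => mkInr n m * y ∈ deg n (1 + q)) ?_ ?_ ?_ hy
      · intro y
        rw [mul_comm, mkInl_mul_mkInr]
        exact mkInr_mem n _
      · intro m'
        rw [mkInr_mul_mkInr]
        exact zero_mem _
      · intro q
        rw [mul_zero]
        exact zero_mem _
    · intro _ _
      rw [zero_mul]
      exact zero_mem _

/-- The embedding of degree zero, with values in the homogeneous component. -/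
noncomputable def toDegZero (n : ℕ) : WittVector 2 A →+ (deg n 0 : AddSubgroup (Level A n)) :=
  (mkInl n).toAddMonoidHom.codRestrict _ (mkInl_mem n)

/-- The embedding of degree one, with values in the homogeneous component. -/
noncomputable def toDegOne (n : ℕ) : DrwOne A →+ (deg n 1 : AddSubgroup (Level A n)) :=
  (mkInr n).codRestrict _ (mkInr_mem n)

open DirectSum

/-- The decomposition into homogeneous components. -/
noncomputable def decompose (n : ℕ) : Level A n →+ ⨁ q, (deg n q : AddSubgroup (Level A n)) :=
  QuotientAddGroup.lift _
    (((DirectSum.of (fun q => (deg n q : AddSubgroup (Level A n))) 0).comp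
        (toDegZero n)).comp fst.toAddMonoidHom
      + ((DirectSum.of (fun q => (deg n q : AddSubgroup (Level A n))) 1).comp
        (toDegOne n)).comp snd)
    (by
      intro z hz
      have h0 : toDegZero n (fst z) = 0 := Subtype.ext (mkInl_eq_zero.mpr hz.1)
      have h1 : toDegOne n (snd z) = 0 := Subtype.ext (mkInr_eq_zero.mpr hz.2)
      change DirectSum.of (fun q => (deg n q : AddSubgroup (Level A n))) 0 (toDegZero n (fst z))
        + DirectSum.of (fun q => (deg n q : AddSubgroup (Level A n))) 1 (toDegOne n (snd z)) = 0
      rw [h0, h1, map_zero, map_zero, add_zero])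

theorem decompose_proj (n : ℕ) (z : Drw A) :
    decompose n (proj n z)
      = DirectSum.of (fun q => (deg n q : AddSubgroup (Level A n))) 0 (toDegZero n (fst z))
        + DirectSum.of (fun q => (deg n q : AddSubgroup (Level A n))) 1 (toDegOne n (snd z)) :=
  rfl

noncomputable instance (n : ℕ) : GradedRing (deg n : ℕ → AddSubgroup (Level A n)) where
  toDecomposition := DirectSum.Decomposition.ofAddHom _ (decompose n)
    (by
      ext x
      obtain ⟨z, rfl⟩ := proj_surjective n x
      rw [AddMonoidHom.comp_apply, decompose_proj, map_add, DirectSum.coeAddMonoidHom_of,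
        DirectSum.coeAddMonoidHom_of]
      exact (proj_eq_add n z).symm)
    (by
      refine DirectSum.addHom_ext fun q ⟨x, hx⟩ => ?_
      rw [AddMonoidHom.comp_apply, DirectSum.coeAddMonoidHom_of, AddMonoidHom.id_apply]
      match q, hx with
      | 0, ⟨y, hy⟩ =>
        subst hy
        refine (decompose_proj n (inl y)).trans ?_
        rw [snd_inl, map_zero, map_zero, add_zero]
        rfl
      | 1, ⟨m, hm⟩ =>
        subst hm
        refine (decompose_proj n (inr m)).trans ?_
        rw [fst_inr, map_zero, map_zero, zero_add]
        rfl
      | q + 2, hx =>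
        obtain rfl := AddSubgroup.mem_bot.mp hx
        rw [map_zero]
        exact (map_zero _).symm)

/-- The map `λ`. -/
noncomputable def lam (n : ℕ) : TwoWitt n A →+* Level A n :=
  (truncate n : WittVector 2 A →+* TwoWitt n A).liftOfSurjective
    (truncate_surjective 2 n A) ⟨mkInl n, fun _ h => mkInl_eq_zero.mpr h⟩

theorem lam_truncate (n : ℕ) (x : WittVector 2 A) : lam n (truncate n x) = mkInl n x :=
  RingHom.liftOfRightInverse_comp_apply _ _ _ _ _

/-- The restriction. -/
noncomputable def levelRes (n : ℕ) : Level A (n + 1) →+* Level A n :=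
  Ideal.Quotient.factor (fil_succ_le n)

/-- The Frobenius between the levels. -/
noncomputable def levelFrob (n : ℕ) : Level A (n + 1) →+* Level A n :=
  Ideal.quotientMap _ frob fun _ hz => frob_mem_fil hz

/-- The Verschiebung between the levels. -/
noncomputable def levelVer (n : ℕ) : Level A n →+ Level A (n + 1) :=
  levelMap n (n + 1) ver fun _ hz => ver_mem_fil hz

/-- The differential on a level. -/
noncomputable def levelDiff (n : ℕ) : Level A n →+ Level A n :=
  levelMap n n diff fun _ hz => diff_mem_fil hz

theorem levelFrob_proj (n : ℕ) (z : Drw A) : levelFrob n (proj (n + 1) z) = proj n (frob z) := rfl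

theorem levelVer_proj (n : ℕ) (z : Drw A) : levelVer n (proj n z) = proj (n + 1) (ver z) := rfl

theorem levelDiff_proj (n : ℕ) (z : Drw A) : levelDiff n (proj n z) = proj n (diff z) := rfl

theorem diff_inr (m : DrwOne A) : diff (inr m) = 0 := by
  ext1 <;> simp

theorem diff_inl (x : WittVector 2 A) : diff (inl x) = inr (drwDiff x) := rfl

theorem frob_inl (x : WittVector 2 A) : frob (inl x) = inl (frobenius x) := by
  ext1 <;> simp

theorem frob_inr (m : DrwOne A) : frob (inr m) = inr (DrwOne.frob m) := by
  ext1 <;> simp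

theorem ver_inl (x : WittVector 2 A) : ver (inl x) = inl (verschiebung x) := by
  ext1 <;> simp

theorem ver_inr (m : DrwOne A) : ver (inr m) = inr (DrwOne.ver m) := by
  ext1 <;> simp

theorem ver_mul (z w : Drw A) : ver z * w = ver (z * frob w) := by
  ext1
  · simp [verschiebung_mul_frobenius]
  · simp [DrwOne.verschiebung_smul, DrwOne.ver_smul]

theorem frob_ver (z : Drw A) : frob (ver z) = 2 * z := by
  rw [two_mul]
  ext1
  · simp [frobenius_verschiebung, mul_two]
  · simp [DrwOne.frob_ver]

/-- The limit of the elements `dlog [-1]`. -/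
noncomputable def dlogNegOne : Drw A :=
  inl (teichmuller 2 (-1 : A)) * diff (inl (teichmuller 2 (-1 : A)))

theorem dlogNegOne_eq : (dlogNegOne : Drw A) = inr DrwOne.dlogNegOne := by
  rw [dlogNegOne, diff_inl, inl_mul_inr, DrwOne.teichmuller_neg_one_smul_drwDiff]

theorem frob_diff_ver (z : Drw A) : frob (diff (ver z)) = diff z + dlogNegOne * z := by
  rw [dlogNegOne_eq]
  ext1
  · simp
  · simp [DrwOne.frob_drwDiff_verschiebung]

/-- The model has no degree two, so `dd`, `dι` and `ιd` all vanish. -/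
theorem diff_diff (z : Drw A) : diff (diff z) = 0 := by
  ext1 <;> simp

theorem diff_dlogNegOne_mul (z : Drw A) : diff (dlogNegOne * z) = 0 := by
  rw [dlogNegOne_eq]
  ext1 <;> simp

theorem dlogNegOne_mul_diff (z : Drw A) : dlogNegOne * diff z = 0 := by
  rw [dlogNegOne_eq]
  ext1 <;> simp

theorem frob_diff_teichmuller (a : A) :
    frob (diff (inl (teichmuller 2 a))) = inl (teichmuller 2 a) * diff (inl (teichmuller 2 a)) := by
  rw [diff_inl, frob_inr, inl_mul_inr, DrwOne.frob_drwDiff_teichmuller]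

variable (A) in
/-- The explicit Witt complex without the relations for the differential. -/
noncomputable def preWittComplex : PreWittComplex A where
  X := Level A
  deg := deg
  mul_comm_deg {n p q x y} hx hy := by
    -- The ring is commutative, so the sign matters only for `p = q = 1`, where the product is zero.
    rw [mul_comm y x]
    revert hy
    refine deg_induction (P := fun p x => y ∈ deg n q → x * y = (-1) ^ (p * q) * (x * y))
      ?_ ?_ ?_ hx
    · intro x _
      rw [zero_mul, pow_zero, one_mul]
    · intro m hy
      refine deg_induction
        (P := fun q y => mkInr n m * y = (-1) ^ (1 * q) * (mkInr n m * y)) ?_ ?_ ?_ hy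
      · intro y
        rw [mul_zero, pow_zero, one_mul]
      · intro m'
        rw [mkInr_mul_mkInr, mul_zero]
      · intro q
        rw [mul_zero, mul_zero]
    · intro q _
      rw [zero_mul, mul_zero]
  level_zero := by
    refine ⟨fun x y => ?_⟩
    obtain ⟨z, rfl⟩ := proj_surjective 0 x
    obtain ⟨w, rfl⟩ := proj_surjective 0 y
    rw [← sub_eq_zero, ← map_sub, proj_eq_zero, mem_fil]
    exact ⟨by ext i; exact i.elim0, fun j hj => by omega⟩
  R := levelRes
  R_deg {n q x} hx := by
    refine deg_induction (P := fun q x => levelRes n x ∈ deg n q) (fun x => mkInl_mem n x)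
      (fun m => mkInr_mem n m) (fun q => ?_) hx
    rw [map_zero]
    exact zero_mem _
  lam := lam
  lam_deg n a := by
    obtain ⟨x, rfl⟩ := truncate_surjective 2 n A a
    rw [lam_truncate]
    exact mkInl_mem n x
  R_lam n a := by
    obtain ⟨x, rfl⟩ := truncate_surjective 2 (n + 1) A a
    rw [TwoWitt.res_truncate, lam_truncate, lam_truncate]
    rfl
  F := levelFrob
  F_deg {n q x} hx := by
    refine deg_induction (P := fun q x => levelFrob n x ∈ deg n q) (fun x => ?_)
      (fun m => ?_) (fun q => ?_) hx
    · rw [mkInl_apply, levelFrob_proj, frob_inl]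
      exact mkInl_mem n _
    · rw [mkInr_apply, levelFrob_proj, frob_inr]
      exact mkInr_mem n _
    · rw [map_zero]
      exact zero_mem _
  R_F n x := by
    obtain ⟨z, rfl⟩ := proj_surjective _ x
    rfl
  F_lam n a := by
    obtain ⟨x, rfl⟩ := truncate_surjective 2 (n + 1) A a
    rw [TwoWitt.frob_truncate, lam_truncate, lam_truncate, mkInl_apply, levelFrob_proj, frob_inl]
    rfl
  V := levelVer
  V_deg {n q x} hx := by
    refine deg_induction (P := fun q x => levelVer n x ∈ deg (n + 1) q) (fun x => ?_)
      (fun m => ?_) (fun q => ?_) hx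
    · rw [mkInl_apply, levelVer_proj, ver_inl]
      exact mkInl_mem _ _
    · rw [mkInr_apply, levelVer_proj, ver_inr]
      exact mkInr_mem _ _
    · rw [map_zero]
      exact zero_mem _
  R_V n x := by
    obtain ⟨z, rfl⟩ := proj_surjective _ x
    rfl
  V_lam n a := by
    obtain ⟨x, rfl⟩ := truncate_surjective 2 n A a
    rw [TwoWitt.ver_truncate, lam_truncate, lam_truncate, mkInl_apply, levelVer_proj, ver_inl]
    rfl
  V_mul n x y := by
    obtain ⟨z, rfl⟩ := proj_surjective _ x
    obtain ⟨w, rfl⟩ := proj_surjective _ y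
    rw [levelVer_proj, levelFrob_proj, ← map_mul, ← map_mul, levelVer_proj, ver_mul]
  d := levelDiff
  d_deg {n q x} hx := by
    refine deg_induction (P := fun q x => levelDiff n x ∈ deg n (q + 1)) (fun x => ?_)
      (fun m => ?_) (fun q => ?_) hx
    · exact mkInr_mem _ _
    · rw [mkInr_apply, levelDiff_proj, diff_inr, map_zero]
      exact zero_mem _
    · rw [map_zero]
      exact zero_mem _
  R_d n x := by
    obtain ⟨z, rfl⟩ := proj_surjective _ x
    rfl
  d_mul {n p x} y hx := by
    obtain ⟨w, rfl⟩ := proj_surjective _ y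
    refine deg_induction (P := fun p x => levelDiff n (x * proj n w)
      = levelDiff n x * proj n w + (-1) ^ p * (x * levelDiff n (proj n w)))
      (fun x => ?_) (fun m => ?_) (fun q => ?_) hx
    · rw [pow_zero, one_mul, mkInl_apply, ← map_mul, levelDiff_proj, levelDiff_proj,
        levelDiff_proj, ← map_mul, ← map_mul, ← map_add]
      congr 1
      ext1
      · simp
      · simp [DrwOne.drwDiff_mul, add_comm]
    · rw [mkInr_apply, ← map_mul, levelDiff_proj, levelDiff_proj, levelDiff_proj, diff_inr,
        map_zero, zero_mul, zero_add, ← map_mul]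
      have h1 : diff (inr m * w) = 0 := by ext1 <;> simp
      have h2 : inr m * diff w = 0 := by ext1 <;> simp
      rw [h1, h2, map_zero, mul_zero]
    · rw [map_zero, zero_mul, zero_mul, map_zero, mul_zero, add_zero]

theorem preWittComplex_iota (n : ℕ) (z : Drw A) :
    (preWittComplex A).iota n (proj n z) = proj n (dlogNegOne * z) := by
  rw [map_mul]
  change lam n (truncate n _) * levelDiff n (lam n (truncate n _)) * _ = _
  rw [lam_truncate, mkInl_apply, levelDiff_proj, ← map_mul]
  rfl

variable (A) in
/-- The explicit Witt complex. -/
noncomputable def wittComplex : WittComplex A where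
  toPreWittComplex := preWittComplex A
  F_V n x := by
    obtain ⟨z, rfl⟩ := proj_surjective _ x
    refine (congrArg (proj n) (frob_ver z)).trans ?_
    rw [map_mul, map_ofNat]
    rfl
  F_d_V n x := by
    obtain ⟨z, rfl⟩ := proj_surjective _ x
    rw [preWittComplex_iota]
    refine (congrArg (proj n) (frob_diff_ver z)).trans ?_
    rw [map_add]
    rfl
  d_d n x := by
    obtain ⟨z, rfl⟩ := proj_surjective _ x
    rw [preWittComplex_iota]
    exact congrArg (proj n) ((diff_diff z).trans (diff_dlogNegOne_mul z).symm)
  d_iota n x := by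
    obtain ⟨z, rfl⟩ := proj_surjective _ x
    rw [preWittComplex_iota]
    refine (congrArg (proj n) ((diff_dlogNegOne_mul z).trans (dlogNegOne_mul_diff z).symm)).trans ?_
    exact (preWittComplex_iota n (diff z)).symm
  F_d_teich n a := by
    change levelFrob n (levelDiff (n + 1) (lam (n + 1) (truncate (n + 1) _)))
      = lam n (truncate n _) * levelDiff n (lam n (truncate n _))
    rw [lam_truncate, lam_truncate, mkInl_apply, mkInl_apply, levelDiff_proj, levelDiff_proj,
      levelFrob_proj, frob_diff_teichmuller, map_mul]
    rfl

end Drw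

open WittVector ZModTwoPow

/-! ### Generators of degree one and comparison of quotients -/

theorem exists_addEquiv_of_ker_eq {G B C : Type*} [AddCommGroup G] [AddCommGroup B]
    [AddCommGroup C] (g : G →+ B) (f : G →+ C) (hg : Function.Surjective g)
    (hf : Function.Surjective f) (h : ∀ x, g x = 0 ↔ f x = 0) :
    ∃ φ : B ≃+ C, ∀ x, φ (g x) = f x := by
  have hker : g.ker = f.ker := by
    ext x
    exact h x
  refine ⟨(QuotientAddGroup.quotientKerEquivOfSurjective g hg).symm.trans
    ((QuotientAddGroup.quotientAddEquivOfEq hker).trans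
      (QuotientAddGroup.quotientKerEquivOfSurjective f hf)), fun x => ?_⟩
  have : (QuotientAddGroup.quotientKerEquivOfSurjective g hg).symm (g x) = (x : G ⧸ g.ker) := by
    rw [AddEquiv.symm_apply_eq]
    rfl
  rw [AddEquiv.trans_apply, this]
  rfl

namespace DrwOne

variable {A : Type}

/-- The element with prescribed integers as components. -/
def ofInt : (ℕ → ℤ) →+ DrwOne A where
  toFun c j := (c j : ZMod (2 ^ (j + 1)))
  map_zero' := by
    ext j
    exact Int.cast_zero
  map_add' c c' := by
    ext j
    exact Int.cast_add _ _

theorem ofInt_apply (c : ℕ → ℤ) (j : ℕ) :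
    (ofInt c : DrwOne A) j = (c j : ZMod (2 ^ (j + 1))) := rfl

theorem ofInt_surjective : Function.Surjective (ofInt : (ℕ → ℤ) →+ DrwOne A) := by
  intro m
  choose c hc using fun j => ZMod.intCast_surjective (m j)
  exact ⟨c, funext hc⟩

/-- The generator `dV^{j+1}(1)`. -/
def gen (j : ℕ) : DrwOne A := ofInt fun k => if k = j then 1 else 0

/-- The sum of the elements `2^i dV^{i+1}(1)` for `i ≥ k`. -/
def tail (k : ℕ) : DrwOne A := ofInt fun i => if k ≤ i then 2 ^ i else 0

theorem gen_apply (j k : ℕ) : (gen j : DrwOne A) k = if k = j then 1 else 0 := by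
  rw [gen, ofInt_apply]
  split_ifs <;> simp

theorem tail_apply (k i : ℕ) : (tail k : DrwOne A) i = if k ≤ i then inc i 1 else 0 := by
  rw [tail, ofInt_apply, ← Int.cast_one, inc_intCast]
  split_ifs <;> simp

theorem nsmul_apply (n : ℕ) (m : DrwOne A) (j : ℕ) : (n • m) j = n • m j := rfl

theorem tau_gen (k j : ℕ) : tau k (gen j : DrwOne A) = if j < k then 1 else 0 := by
  induction k with
  | zero => rfl
  | succ k ih =>
    rw [tau_succ, ih, gen_apply]
    split_ifs
    all_goals first | omega | simp

theorem frob_gen_zero : frob (gen 0 : DrwOne A) = tail 0 := by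
  ext i
  rw [frob_apply, tau_gen, gen_apply, tail_apply, if_neg (by omega), if_pos (by omega),
    if_pos (by omega), map_zero, zero_add]

theorem frob_gen_succ (j : ℕ) : frob (gen (j + 1) : DrwOne A) = gen j + tail (j + 1) := by
  ext i
  rw [frob_apply, tau_gen, gen_apply, add_apply, gen_apply, tail_apply]
  congr 1
  · split_ifs
    all_goals first | omega | simp
  · split_ifs
    all_goals first | omega | simp

theorem ver_gen (j : ℕ) : ver (gen j : DrwOne A) = 2 • gen (j + 1) := by
  ext i
  rw [nsmul_apply, gen_apply]
  cases i with
  | zero => rw [ver_apply_zero, if_neg (by omega), smul_zero]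
  | succ i =>
    rw [ver_apply_succ, gen_apply]
    split_ifs
    all_goals first | omega | skip
    · rw [← Int.cast_one, dbl_intCast]
      simp
    · simp

/-- Additive maps that factor through level `n` and agree on the generators are equal. -/
theorem addMonoidHom_ext {N : Type*} [AddCommGroup N] (n : ℕ) {f g : DrwOne A →+ N}
    (hf : ∀ m : DrwOne A, (∀ j, j + 1 < n → m j = 0) → f m = 0)
    (hg : ∀ m : DrwOne A, (∀ j, j + 1 < n → m j = 0) → g m = 0)
    (h : ∀ j, j + 1 < n → f (gen j) = g (gen j)) : f = g := by
  ext m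
  obtain ⟨c, rfl⟩ := ofInt_surjective m
  -- The infinite product is not spanned by the generators, but modulo elements vanishing below
  -- level `n` finitely many of them suffice.
  have hz : ∀ j, j + 1 < n →
      (ofInt c - ∑ k ∈ Finset.range (n - 1), c k • gen k : DrwOne A) j = 0 := by
    intro j hj
    have : (∑ k ∈ Finset.range (n - 1), c k • gen k : DrwOne A)
        = ofInt (fun i => if i < n - 1 then c i else 0) := by
      simp only [gen, ← map_zsmul, ← map_sum]
      congr 1
      ext i
      simp [Finset.sum_apply]
    rw [this, ← map_sub, ofInt_apply, Pi.sub_apply, if_pos (by omega), sub_self, Int.cast_zero]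
  have h1 := (hf _ hz).trans (hg _ hz).symm
  rw [map_sub, map_sub] at h1
  have h2 : f (∑ k ∈ Finset.range (n - 1), c k • gen k)
      = g (∑ k ∈ Finset.range (n - 1), c k • gen k) := by
    rw [map_sum, map_sum]
    refine Finset.sum_congr rfl fun k hk => ?_
    have := Finset.mem_range.mp hk
    rw [map_zsmul, map_zsmul, h k (by omega)]
  rwa [h2, sub_left_inj] at h1

variable [CommRing A] [TwoIntegral A]

theorem drwDiff_iterate_verschiebung_one (i : ℕ) :
    drwDiff (verschiebung^[i + 1] (1 : WittVector 2 A)) = gen i := by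
  ext j
  rw [drwDiff_apply, ghostDiff_iterate_verschiebung_one, gen_apply]
  split_ifs
  all_goals first | omega | simp

theorem iterate_verschiebung_one_smul_gen (i j : ℕ) :
    verschiebung^[i + 1] (1 : WittVector 2 A) • (gen j : DrwOne A)
      = 2 ^ (i + 1) • gen j + tail (max (i + 1) (j + 1)) := by
  ext k
  rw [smul_apply, drwDiff_iterate_verschiebung_one, tau_gen, tau_gen, add_apply, nsmul_apply,
    tail_apply, ghostMod, RingHom.comp_apply, ghostComponent_iterate_verschiebung_one, gen_apply]
  congr 1
  · by_cases h : k = j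
    · rw [if_pos h, mul_one, nsmul_eq_mul, mul_one]
      split_ifs with h1
      · rw [map_pow, map_ofNat]
        push_cast
        rfl
      -- Here the ghost component `w_{k+1}` of `V^(i+1)(1)` is zero, and so is `2^(i+1)` in
      -- `ℤ/2^(k+1)`.
      · obtain ⟨l, rfl⟩ := Nat.exists_eq_add_of_le (show k + 1 ≤ i by omega)
        push_cast
        rw [map_zero, add_assoc, pow_add _ (k + 1), two_pow_eq_zero (k + 1), zero_mul]
    · rw [if_neg h, mul_zero, smul_zero]
  · split_ifs
    all_goals first | omega | simp

end DrwOne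

/-! ### The morphism from the model to an arbitrary Witt complex -/

namespace WittComplex

variable {A : Type} [CommRing A] (E : WittComplex A)

theorem map_vOne {E E' : WittComplex A} (g : E ⟶ E') (n i : ℕ) :
    g.f n (E.vOne n i) = E'.vOne n i := by
  rw [vOne_eq_lam, vOne_eq_lam]
  exact g.f_lam n _

theorem map_dvOne {E E' : WittComplex A} (g : E ⟶ E') (n i : ℕ) :
    g.f n (E.dvOne n i) = E'.dvOne n i := by
  rw [dvOne, dvOne, ← map_vOne g]
  exact g.f_d n _

/-- The multiples of `dV^{j+1}(1)`. -/
noncomputable def dvOneHom (n j : ℕ) : ZMod (2 ^ (j + 1)) →+ E.X n :=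
  ZMod.lift _ ⟨zmultiplesHom _ (E.dvOne n (j + 1)), by
    rw [zmultiplesHom_apply, natCast_zsmul, two_pow_nsmul_dvOne]⟩

theorem dvOneHom_intCast (n j : ℕ) (c : ℤ) :
    E.dvOneHom n j (c : ZMod (2 ^ (j + 1))) = c • E.dvOne n (j + 1) := by
  simp [dvOneHom]

/-- The map from the explicit model in degree one. -/
noncomputable def oneMap (n : ℕ) : DrwOne A →+ E.X n where
  toFun m := ∑ j ∈ Finset.range (n - 1), E.dvOneHom n j (m j)
  map_zero' := by simp
  map_add' m m' := by simp [Finset.sum_add_distrib]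

theorem oneMap_apply (n : ℕ) (m : DrwOne A) :
    E.oneMap n m = ∑ j ∈ Finset.range (n - 1), E.dvOneHom n j (m j) := rfl

theorem oneMap_ofInt (n : ℕ) (c : ℕ → ℤ) :
    E.oneMap n (DrwOne.ofInt c) = ∑ j ∈ Finset.range (n - 1), c j • E.dvOne n (j + 1) :=
  (E.oneMap_apply n _).trans (Finset.sum_congr rfl fun j _ => E.dvOneHom_intCast n j (c j))

theorem oneMap_eq_zero {n : ℕ} {m : DrwOne A} (h : ∀ j, j + 1 < n → m j = 0) :
    E.oneMap n m = 0 := by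
  rw [oneMap_apply]
  refine Finset.sum_eq_zero fun j hj => ?_
  have := Finset.mem_range.mp hj
  rw [h j (by omega), map_zero]

theorem oneMap_gen (n j : ℕ) : E.oneMap n (DrwOne.gen j) = E.dvOne n (j + 1) := by
  rw [DrwOne.gen, oneMap_ofInt]
  simp only [ite_smul, one_smul, zero_smul, Finset.sum_ite_eq', Finset.mem_range]
  split_ifs with h
  · rfl
  · rw [dvOne_eq_zero E (by omega)]

theorem oneMap_tail (n k : ℕ) : E.oneMap n (DrwOne.tail k) = E.dvTail n k := by
  cases n with
  | zero => exact @Subsingleton.elim _ E.level_zero _ _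
  | succ n =>
    rw [DrwOne.tail, oneMap_ofInt, dvTail, ← Finset.sum_Ico_add', Nat.add_sub_cancel]
    simp only [ite_smul, zero_smul]
    rw [← Finset.sum_filter]
    refine Finset.sum_congr ?_ fun i _ => ?_
    · ext i
      simp [and_comm]
    · rw [Nat.add_sub_cancel, ← natCast_zsmul]
      push_cast
      rfl

theorem oneMap_mem (n : ℕ) (m : DrwOne A) : E.oneMap n m ∈ E.deg n 1 := by
  obtain ⟨c, rfl⟩ := DrwOne.ofInt_surjective m
  rw [oneMap_ofInt]
  exact sum_mem fun j _ => zsmul_mem (E.dvOne_mem n _) _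

theorem oneMap_mul_oneMap (n : ℕ) (m m' : DrwOne A) : E.oneMap n m * E.oneMap n m' = 0 := by
  obtain ⟨c, rfl⟩ := DrwOne.ofInt_surjective m
  obtain ⟨c', rfl⟩ := DrwOne.ofInt_surjective m'
  rw [oneMap_ofInt, oneMap_ofInt, Finset.sum_mul_sum]
  refine Finset.sum_eq_zero fun i _ => Finset.sum_eq_zero fun j _ => ?_
  rw [smul_mul_smul_comm, dvOne_mul_dvOne, smul_zero]

theorem d_oneMap (n : ℕ) (m : DrwOne A) : E.d n (E.oneMap n m) = 0 := by
  obtain ⟨c, rfl⟩ := DrwOne.ofInt_surjective m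
  rw [oneMap_ofInt, map_sum]
  refine Finset.sum_eq_zero fun i _ => ?_
  rw [map_zsmul, d_dvOne, smul_zero]

theorem R_oneMap (n : ℕ) (m : DrwOne A) : E.R n (E.oneMap (n + 1) m) = E.oneMap n m := by
  refine DFunLike.congr_fun (DrwOne.addMonoidHom_ext (n + 1)
    (f := (E.R n).toAddMonoidHom.comp (E.oneMap (n + 1))) (g := E.oneMap n)
    (fun m hm => ?_) (fun m hm => ?_) fun j _ => ?_) m
  · exact (congrArg (E.R n) (E.oneMap_eq_zero hm)).trans (map_zero _)
  · exact E.oneMap_eq_zero fun j hj => hm j (by omega)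
  · rw [oneMap_gen, ← R_dvOne_eq, ← oneMap_gen]
    rfl

theorem F_oneMap (n : ℕ) (m : DrwOne A) :
    E.F n (E.oneMap (n + 1) m) = E.oneMap n (DrwOne.frob m) := by
  refine DFunLike.congr_fun (DrwOne.addMonoidHom_ext (n + 1)
    (f := (E.F n).toAddMonoidHom.comp (E.oneMap (n + 1))) (g := (E.oneMap n).comp DrwOne.frob)
    (fun m hm => ?_) (fun m hm => ?_) fun j _ => ?_) m
  · exact (congrArg (E.F n) (E.oneMap_eq_zero hm)).trans (map_zero _)
  · refine E.oneMap_eq_zero fun j hj => ?_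
    rw [DrwOne.frob_apply, hm _ (by omega), DrwOne.tau_eq_zero fun k hk => hm k (by omega)]
    simp
  · refine (congrArg (E.F n) (E.oneMap_gen _ _)).trans ?_
    rw [F_dvOne_succ, AddMonoidHom.comp_apply]
    cases j with
    | zero => rw [DrwOne.frob_gen_zero, oneMap_tail, dvOne_zero, zero_add]
    | succ j => rw [DrwOne.frob_gen_succ, map_add, oneMap_gen, oneMap_tail]

theorem V_oneMap (n : ℕ) (m : DrwOne A) :
    E.V n (E.oneMap n m) = E.oneMap (n + 1) (DrwOne.ver m) := by
  refine DFunLike.congr_fun (DrwOne.addMonoidHom_ext n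
    (f := (E.V n).comp (E.oneMap n)) (g := (E.oneMap (n + 1)).comp DrwOne.ver)
    (fun m hm => ?_) (fun m hm => ?_) fun j _ => ?_) m
  · exact (congrArg (E.V n) (E.oneMap_eq_zero hm)).trans (map_zero _)
  · refine E.oneMap_eq_zero fun j hj => ?_
    cases j with
    | zero => rfl
    | succ j => rw [DrwOne.ver_apply_succ, hm j (by omega), map_zero]
  · rw [AddMonoidHom.comp_apply, AddMonoidHom.comp_apply, oneMap_gen, V_dvOne_eq, DrwOne.ver_gen,
      map_nsmul, oneMap_gen]

/-- The map `λ` on untruncated Witt vectors. -/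
noncomputable def lamInf (n : ℕ) : WittVector 2 A →+* E.X n := (E.lam n).comp (truncate n)

theorem lamInf_eq_zero {n : ℕ} {x : WittVector 2 A} (h : truncate n x = 0) :
    E.lamInf n x = 0 := by
  rw [lamInf, RingHom.comp_apply, h, map_zero]

theorem lamInf_mem (n : ℕ) (x : WittVector 2 A) : E.lamInf n x ∈ E.deg n 0 := E.lam_deg n _

theorem lamInf_iterate_verschiebung_one (n i : ℕ) :
    E.lamInf n (verschiebung^[i] 1) = E.vOne n i := (E.vOne_eq_lam n i).symm

variable [TwoIntegral A]

theorem eq_zero_of_intCast_smul (n : ℕ) {q : ℤ} {y : E.X n} (hq : IsUnit (q : A))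
    (h : q • y = 0) : y = 0 := by
  obtain ⟨u, hu⟩ := exists_intCast_mul_truncate_eq_one hq n
  rw [← one_mul y, ← map_one (E.lam n), ← hu, mul_comm, map_mul, map_intCast, mul_assoc,
    ← zsmul_eq_mul, h, mul_zero]

/-- Both sides are biadditive and factor through level `n`, so it suffices to take `x = V^i(1)` and
`m = dV^(j+1)(1)`, where the universal product formula and the action in the model agree. -/
theorem lamInf_mul_oneMap (n : ℕ) (x : WittVector 2 A) (m : DrwOne A) :
    E.lamInf n x * E.oneMap n m = E.oneMap n (x • m) := by
  refine DFunLike.congr_fun (DrwOne.addMonoidHom_ext n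
    (f := (AddMonoidHom.mulLeft (E.lamInf n x)).comp (E.oneMap n))
    (g := (E.oneMap n).comp (DistribSMul.toAddMonoidHom (DrwOne A) x))
    (fun m hm => ?_) (fun m hm => ?_) fun j hj => ?_) m
  · exact (congrArg (E.lamInf n x * ·) (E.oneMap_eq_zero hm)).trans (mul_zero _)
  · refine E.oneMap_eq_zero fun j hj => ?_
    rw [DistribSMul.toAddMonoidHom_apply, DrwOne.smul_apply, hm j hj,
      DrwOne.tau_eq_zero fun k hk => hm k (by omega)]
    simp
  · refine DFunLike.congr_fun (eq_of_eq_iterate_verschiebung_one n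
      (fun q y hq h => E.eq_zero_of_intCast_smul n hq h)
      ((AddMonoidHom.mulRight (E.oneMap n (DrwOne.gen j))).comp (E.lamInf n).toAddMonoidHom)
      ((E.oneMap n).comp ((smulAddHom (WittVector 2 A) (DrwOne A)).flip (DrwOne.gen j)))
      (fun x hx => ?_) (fun x hx => ?_) fun i hi => ?_) x
    · exact (congrArg (· * _) (E.lamInf_eq_zero hx)).trans (zero_mul _)
    · refine E.oneMap_eq_zero fun k hk => ?_
      change (x • (DrwOne.gen j : DrwOne A)) k = 0
      rw [DrwOne.smul_apply, ghostMod_eq_zero hx hk,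
        DrwOne.tau_eq_zero fun l hl => drwDiff_eq_zero hx (by omega)]
      simp
    · change E.lamInf n (verschiebung^[i] 1) * E.oneMap n (DrwOne.gen j)
        = E.oneMap n (verschiebung^[i] (1 : WittVector 2 A) • DrwOne.gen j)
      cases i with
      | zero => rw [Function.iterate_zero_apply, map_one, one_mul, one_smul]
      | succ i =>
        rw [lamInf_iterate_verschiebung_one, oneMap_gen,
          vOne_mul_dvOne E n (Nat.succ_pos i) (Nat.succ_pos j),
          DrwOne.iterate_verschiebung_one_smul_gen, map_add, map_nsmul, oneMap_gen, oneMap_tail]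

theorem d_lamInf (n : ℕ) (x : WittVector 2 A) :
    E.d n (E.lamInf n x) = E.oneMap n (drwDiff x) := by
  refine DFunLike.congr_fun (eq_of_eq_iterate_verschiebung_one n
    (fun q y hq h => E.eq_zero_of_intCast_smul n hq h)
    ((E.d n).comp (E.lamInf n).toAddMonoidHom) ((E.oneMap n).comp drwDiff)
    (fun x hx => ?_) (fun x hx => ?_) fun i hi => ?_) x
  · exact (congrArg (E.d n) (E.lamInf_eq_zero hx)).trans (map_zero _)
  · exact E.oneMap_eq_zero fun k hk => drwDiff_eq_zero hx hk
  · refine (congrArg (E.d n) (E.lamInf_iterate_verschiebung_one n i)).trans ?_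
    rw [AddMonoidHom.comp_apply]
    cases i with
    | zero => rw [vOne_zero, d_one_eq_zero, Function.iterate_zero_apply, drwDiff_one, map_zero]
    | succ i => rw [DrwOne.drwDiff_iterate_verschiebung_one, oneMap_gen, dvOne]

/-- The map from the limit of the explicit rings. -/
noncomputable def drwHom (n : ℕ) : Drw A →+* E.X n where
  toFun z := E.lamInf n (Drw.fst z) + E.oneMap n (Drw.snd z)
  map_one' := by simp
  map_mul' z w := by
    rw [map_mul, map_mul, Drw.snd_mul, map_add, ← lamInf_mul_oneMap, ← lamInf_mul_oneMap, add_mul,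
      mul_add, mul_add, oneMap_mul_oneMap,
      E.commute_of_mem (E.lamInf_mem n (Drw.fst w)) (E.oneMap_mem n (Drw.snd z))]
    abel
  map_zero' := by simp
  map_add' z w := by
    rw [map_add, map_add, map_add, map_add, add_add_add_comm]

theorem drwHom_apply (n : ℕ) (z : Drw A) :
    E.drwHom n z = E.lamInf n (Drw.fst z) + E.oneMap n (Drw.snd z) := rfl

/-- The map from a level of the explicit Witt complex. -/
noncomputable def levelHom (n : ℕ) : Drw.Level A n →+* E.X n :=
  Ideal.Quotient.lift (Drw.fil n) (E.drwHom n) fun z hz => by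
    rw [drwHom_apply, lamInf_eq_zero E hz.1, oneMap_eq_zero E hz.2, add_zero]

theorem levelHom_proj (n : ℕ) (z : Drw A) :
    E.levelHom n (Drw.proj n z) = E.lamInf n (Drw.fst z) + E.oneMap n (Drw.snd z) := rfl

/-- The map from the explicit Witt complex. -/
noncomputable def homOfDrw : Drw.wittComplex A ⟶ E where
  f := E.levelHom
  f_deg {n q x} hx := by
    refine Drw.deg_induction (P := fun q x => E.levelHom n x ∈ E.deg n q) (fun x => ?_)
      (fun m => ?_) (fun q => ?_) hx
    · rw [Drw.mkInl_apply, levelHom_proj, Drw.snd_inl, map_zero, add_zero]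
      exact E.lamInf_mem n _
    · rw [Drw.mkInr_apply, levelHom_proj, Drw.fst_inr, map_zero, zero_add]
      exact E.oneMap_mem n _
    · rw [map_zero]
      exact zero_mem _
  f_R n x := by
    obtain ⟨z, rfl⟩ := Drw.proj_surjective _ x
    change E.levelHom n (Drw.proj n z) = E.R n (E.levelHom (n + 1) (Drw.proj (n + 1) z))
    rw [levelHom_proj, levelHom_proj, map_add, R_oneMap, lamInf, lamInf, RingHom.comp_apply,
      RingHom.comp_apply, E.R_lam, TwoWitt.res_truncate]
  f_lam n a := by
    obtain ⟨x, rfl⟩ := truncate_surjective 2 n A a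
    change E.levelHom n (Drw.lam n (truncate n x)) = _
    rw [Drw.lam_truncate, Drw.mkInl_apply, levelHom_proj, Drw.snd_inl, map_zero, add_zero]
    rfl
  f_d n x := by
    obtain ⟨z, rfl⟩ := Drw.proj_surjective _ x
    change E.levelHom n (Drw.proj n (Drw.diff z)) = E.d n (E.levelHom n (Drw.proj n z))
    rw [levelHom_proj, levelHom_proj, map_add, d_oneMap, d_lamInf, Drw.fst_diff, Drw.snd_diff,
      map_zero, zero_add, add_zero]
  f_F n x := by
    obtain ⟨z, rfl⟩ := Drw.proj_surjective _ x
    change E.levelHom n (Drw.proj n (Drw.frob z))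
      = E.F n (E.levelHom (n + 1) (Drw.proj (n + 1) z))
    rw [levelHom_proj, levelHom_proj, map_add, F_oneMap, lamInf, lamInf, RingHom.comp_apply,
      RingHom.comp_apply, E.F_lam, TwoWitt.frob_truncate, Drw.fst_frob, Drw.snd_frob]
  f_V n x := by
    obtain ⟨z, rfl⟩ := Drw.proj_surjective _ x
    change E.levelHom (n + 1) (Drw.proj (n + 1) (Drw.ver z))
      = E.V n (E.levelHom n (Drw.proj n z))
    rw [levelHom_proj, levelHom_proj, map_add, V_oneMap, lamInf, lamInf, RingHom.comp_apply,
      RingHom.comp_apply, E.V_lam, TwoWitt.ver_truncate, Drw.fst_ver, Drw.snd_ver]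

end WittComplex

/-! ### Initiality of the model and its bases -/

namespace Drw

variable {A : Type} [CommRing A] [TwoIntegral A]

theorem wittComplex_vOne (n i : ℕ) :
    (wittComplex A).vOne n i = mkInl n (verschiebung^[i] 1) := by
  rw [WittComplex.vOne_eq_lam]
  exact lam_truncate n _

theorem wittComplex_dvOne (n i : ℕ) :
    (wittComplex A).dvOne n (i + 1) = mkInr n (DrwOne.gen i) := by
  rw [WittComplex.dvOne, wittComplex_vOne]
  change mkInr n (drwDiff (verschiebung^[i + 1] (1 : WittVector 2 A))) = _
  rw [DrwOne.drwDiff_iterate_verschiebung_one]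

/-- Compatibility with `λ` fixes a morphism in degree zero; compatibility with `d` fixes it on the
`dV^i(1)`, which generate degree one at each level. -/
theorem homOfDrw_unique (E : WittComplex A) (g : wittComplex A ⟶ E) : g = E.homOfDrw := by
  have hl : ∀ (g : wittComplex A ⟶ E) (n : ℕ) (x : WittVector 2 A),
      g.f n (mkInl n x) = E.lamInf n x := by
    intro g n x
    rw [← lam_truncate]
    exact g.f_lam n _
  have hg : ∀ (g : wittComplex A ⟶ E) (n : ℕ) (m : DrwOne A),
      g.f n (mkInr n m) = E.oneMap n m := by
    intro g n m
    refine DFunLike.congr_fun (DrwOne.addMonoidHom_ext n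
      (f := (g.f n).toAddMonoidHom.comp (mkInr n)) (g := E.oneMap n)
      (fun m hm => ?_) (fun m hm => E.oneMap_eq_zero hm) fun j hj => ?_) m
    · exact (congrArg (g.f n) (mkInr_eq_zero.mpr hm)).trans (map_zero _)
    · rw [WittComplex.oneMap_gen, ← WittComplex.map_dvOne g, wittComplex_dvOne]
      rfl
  refine WittComplex.Hom.ext (funext fun n => RingHom.ext fun x => ?_)
  obtain ⟨z, rfl⟩ := proj_surjective n x
  rw [proj_eq_add]
  refine (map_add (g.f n) _ _).trans (Eq.trans ?_ (map_add (E.homOfDrw.f n) _ _).symm)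
  rw [hl, hg, hl, hg]

variable (A) in
/-- The explicit Witt complex is initial. -/
noncomputable def isInitial : Limits.IsInitial (wittComplex A) :=
  Limits.IsInitial.ofUniqueHom (fun E => E.homOfDrw) homOfDrw_unique

theorem exists_addEquiv_deg_zero (n : ℕ) :
    ∃ φ : (Fin n → A) ≃+ (deg n 0 : AddSubgroup (Level A n)),
      ∀ i : Fin n, (φ (Pi.single i 1) : Level A n) = mkInl n (verschiebung^[(i : ℕ)] 1) := by
  -- Both groups are quotients of `W(A)`, by ghost coordinates and by projection to level `n`, with
  -- the same kernel.
  obtain ⟨φ, hφ⟩ := exists_addEquiv_of_ker_eq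
    (AddMonoidHom.mk' (fun (x : WittVector 2 A) (i : Fin n) => ghostCoord (i : ℕ) x)
      (fun x y => by ext i; simp)) (toDegZero n)
    (fun c => by
      obtain ⟨x, hx⟩ := exists_ghostCoord_eq (fun i => if h : i < n then c ⟨i, h⟩ else 0) n
      refine ⟨x, funext fun i => (hx i i.2).trans ?_⟩
      rw [dif_pos i.2])
    (fun ⟨x, y, hy⟩ => ⟨y, Subtype.ext hy⟩)
    (fun x => by
      have h1 : toDegZero n x = 0 ↔ truncate n x = 0 := by
        rw [← mkInl_eq_zero, ← Subtype.coe_inj]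
        rfl
      rw [h1, truncate_eq_zero_iff_ghostCoord, funext_iff]
      exact ⟨fun h i hi => h ⟨i, hi⟩, fun h i => h i i.2⟩)
  refine ⟨φ, fun i => ?_⟩
  have h1 : (Pi.single i 1 : Fin n → A)
      = fun j : Fin n => ghostCoord (j : ℕ) (verschiebung^[(i : ℕ)] (1 : WittVector 2 A)) := by
    ext j
    rw [ghostCoord_iterate_verschiebung_one, Pi.single_apply]
    simp only [Fin.ext_iff, eq_comm]
  rw [h1]
  exact congrArg Subtype.val (hφ (verschiebung^[(i : ℕ)] 1))

theorem exists_addEquiv_deg_one (n : ℕ) :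
    ∃ ψ : ((i : Fin (n - 1)) → ZMod (2 ^ (i.val + 1))) ≃+ (deg n 1 : AddSubgroup (Level A n)),
      ∀ i : Fin (n - 1), (ψ (Pi.single i 1) : Level A n) = mkInr n (DrwOne.gen i) := by
  obtain ⟨φ, hφ⟩ := exists_addEquiv_of_ker_eq
    (AddMonoidHom.mk' (fun (m : DrwOne A) (i : Fin (n - 1)) => m (i : ℕ))
      (fun x y => rfl)) (toDegOne n)
    (fun c => ⟨fun i => if h : i < n - 1 then c ⟨i, h⟩ else 0, funext fun i => dif_pos i.2⟩)
    (fun ⟨x, y, hy⟩ => ⟨y, Subtype.ext hy⟩)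
    (fun x => by
      have h1 : toDegOne n x = 0 ↔ ∀ j, j + 1 < n → x j = 0 := by
        rw [← mkInr_eq_zero, ← Subtype.coe_inj]
        rfl
      rw [h1, funext_iff]
      exact ⟨fun h i hi => h ⟨i, by omega⟩, fun h i => h i (by omega)⟩)
  refine ⟨φ, fun i => ?_⟩
  have h1 : (Pi.single i 1 : (i : Fin (n - 1)) → ZMod (2 ^ (i.val + 1)))
      = fun j : Fin (n - 1) => (DrwOne.gen i : DrwOne A) (j : ℕ) := by
    ext j
    rw [DrwOne.gen_apply]
    rcases eq_or_ne j i with rfl | h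
    · rw [Pi.single_eq_same, if_pos rfl]
    · rw [Pi.single_eq_of_ne h, if_neg (fun h' => h (Fin.ext h'))]
  rw [h1]
  exact congrArg Subtype.val (hφ (DrwOne.gen i))

end Drw

/-! ### Transport of the structure to an arbitrary initial object -/

namespace WittComplex

variable {A : Type} [CommRing A]

/-- An isomorphism of Witt complexes identifies the homogeneous components. -/
def degEquiv {E E' : WittComplex A} (e : E ≅ E') (n q : ℕ) : E.deg n q ≃+ E'.deg n q where
  toFun x := ⟨e.hom.f n x, e.hom.f_deg x.2⟩
  invFun x := ⟨e.inv.f n x, e.inv.f_deg x.2⟩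
  left_inv x := Subtype.ext (RingHom.congr_fun (congrFun (congrArg Hom.f e.hom_inv_id) n) (x : E.X n))
  right_inv x :=
    Subtype.ext (RingHom.congr_fun (congrFun (congrArg Hom.f e.inv_hom_id) n) (x : E'.X n))
  map_add' x y := Subtype.ext (map_add (e.hom.f n) (x : E.X n) y)

theorem coe_degEquiv {E E' : WittComplex A} (e : E ≅ E') (n q : ℕ) (x : E.deg n q) :
    (degEquiv e n q x : E'.X n) = e.hom.f n x := rfl

theorem hasExplicitStructure_of_isInitial [TwoIntegral A] (E : WittComplex A)
    (hE : Limits.IsInitial E) : E.HasExplicitStructure where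
  lam_bijective n := by
    let e := (Drw.isInitial A).uniqueUpToIso hE
    refine ⟨(injective_iff_map_eq_zero _).mpr fun a ha => ?_, Set.Subset.antisymm ?_ ?_⟩
    · obtain ⟨x, rfl⟩ := truncate_surjective 2 n A a
      have h1 := e.inv.f_lam n (truncate n x)
      rw [ha, map_zero] at h1
      exact Drw.mkInl_eq_zero.mp ((Drw.lam_truncate n x).symm.trans h1.symm)
    · rintro _ ⟨a, rfl⟩
      exact E.lam_deg n a
    · intro y hy
      obtain ⟨⟨x, x', hx⟩, hxy⟩ := (degEquiv e n 0).surjective ⟨y, hy⟩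
      refine ⟨truncate n x', ?_⟩
      rw [← e.hom.f_lam]
      refine Eq.trans ?_ (congrArg Subtype.val hxy)
      rw [coe_degEquiv]
      exact congrArg (e.hom.f n) ((Drw.lam_truncate n x').trans hx)
  deg_zero n := by
    let e := (Drw.isInitial A).uniqueUpToIso hE
    obtain ⟨φ, hφ⟩ := Drw.exists_addEquiv_deg_zero (A := A) n
    refine ⟨φ.trans (degEquiv e n 0), fun i => ?_⟩
    rw [← map_vOne e.hom, Drw.wittComplex_vOne, ← hφ]
    rfl
  deg_one n := by
    let e := (Drw.isInitial A).uniqueUpToIso hE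
    obtain ⟨φ, hφ⟩ := Drw.exists_addEquiv_deg_one (A := A) n
    refine ⟨φ.trans (degEquiv e n 1), fun i => ?_⟩
    rw [← map_dvOne e.hom, Drw.wittComplex_dvOne, ← hφ]
    rfl
  deg_ge_two n q hq := by
    let e := (Drw.isInitial A).uniqueUpToIso hE
    obtain ⟨q, rfl⟩ := Nat.exists_eq_add_of_le' hq
    rw [AddSubgroup.eq_bot_iff_forall]
    intro y hy
    obtain ⟨⟨x, hx⟩, hxy⟩ := (degEquiv e n (q + 2)).surjective ⟨y, hy⟩
    obtain rfl := AddSubgroup.mem_bot.mp hx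
    refine (congrArg Subtype.val hxy).symm.trans ?_
    exact map_zero (e.hom.f n)
  -- From here on the formulas hold in every Witt complex; initiality was needed only for the sizes
  -- of the components and for `λ`.
  vOne_mul_vOne n i j h _ := E.vOne_mul_vOne_eq n i j h
  vOne_mul_dvOne_of_lt n i j hi hij _ := by
    rw [vOne_mul_dvOne E n hi (by omega), max_eq_right hij.le]
    rfl
  vOne_mul_dvOne_of_le n i j hj hji _ := by
    rw [vOne_mul_dvOne E n (by omega) hj, max_eq_left hji, two_pow_nsmul_dvOne_of_le E n hji,
      zero_add]
    rfl
  V_vOne _ _ _ := rfl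
  V_dvOne n i _ _ := E.V_dvOne_eq n i
  F_vOne n i _ := by
    rw [vOne_succ, E.F_V, nsmul_eq_mul, Nat.cast_ofNat]
  F_dvOne n i _ := E.F_dvOne_succ n i
  d_one := E.d_one_eq_zero
  iota_vOne n i _ := E.dlogNegOne_mul_vOne n i
  R_vOne n i _ := E.R_vOne_eq n i
  R_vOne_self n := by rw [R_vOne_eq, vOne_eq_zero E le_rfl]
  R_dvOne n i _ _ := E.R_dvOne_eq n i
  R_dvOne_self n _ := by rw [R_dvOne_eq, dvOne_eq_zero E le_rfl]

end WittComplex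

theorem mainTheorem1 :
    (Limits.HasInitial (WittComplex ℤ) ∧
      ∀ E : WittComplex ℤ, Nonempty (Limits.IsInitial E) → E.HasExplicitStructure) ∧
    (Limits.HasInitial (WittComplex ZLocTwo) ∧
      ∀ E : WittComplex ZLocTwo, Nonempty (Limits.IsInitial E) → E.HasExplicitStructure) :=
  ⟨⟨(Drw.isInitial ℤ).hasInitial, fun E ⟨hE⟩ => E.hasExplicitStructure_of_isInitial hE⟩,
    (Drw.isInitial ZLocTwo).hasInitial, fun E ⟨hE⟩ => E.hasExplicitStructure_of_isInitial hE⟩
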